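/- For an integer $p\ge 1$ let $\operatorname{rect}^{\{p\}}$ be the $p$-fold self-convolution of the rectangular function, i.e. $\operatorname{rect}^{\{1\}}=\mathbf 1_{[-1/2,1/2]}$ and $\operatorname{rect}^{\{p\}}(x)=\int_{x-1/2}^{x+1/2}\operatorname{rect}^{\{p-1\}}(s)\,ds$ for $p\ge 2$. Put $$\nu_p=\frac{\int_{\mathbb R}\omega^2\left(\frac{\sin(\omega/2)}{\omega/2}\right)^{2p}d\omega}{\int_{\mathbb R}\left(\frac{\sin(\omega/2)}{\omega/2}\right)^{2p}d\omega},\qquad u_p=\frac{\int_{-p/2}^{p/2}x^2|\operatorname{rect}^{\{p\}}(x)|^2dx}{\int_{-p/2}^{p/2}|\operatorname{rect}^{\{p\}}(x)|^2dx}.$$ For a compactly supported $f$ with $0<\|f\|_{L^2(\mathbb R)}<\infty$ let $\hat f(\omega)=\int_{\mathbb R}e^{-i\omega x}f(x)\,dx$, and let $U(f)=\sigma_x^2[f]\,\sigma_\omega^2[\hat f]\in[0,+\infty]$, where $$\sigma_x^2[f]=\frac1{\|f\|^2}\int_{\mathbb R}(x-\alpha)^2|f(x)|^2dx,\quad \sigma_\omega^2[\hat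 f]=\frac1{2\pi\|f\|^2}\int_{\mathbb R}(\omega-\beta)^2|\hat f(\omega)|^2d\omega,$$ $$\alpha=\frac1{\|f\|^2}\int_{\mathbb R} x|f(x)|^2dx,\qquad \beta=\frac1{2\pi\|f\|^2}\int_{\mathbb R}\omega|\hat f(\omega)|^2d\omega$$ (for $f=\operatorname{rect}^{\{p\}}$ with $p\ge 2$ all these integrals converge). **Theorem.** There exist nonzero real constants $c_1,c_2,c_3,c_4,d_1,d_2,d_3,d_4>-2$, independent of $p$, with $c_2>c_1$, $c_4>c_3$, $d_2>d_1$ and $d_4>d_3$, such that for all integers $p\ge 2$ $$6\,\frac{\sqrt{p+c_2}}{(p+c_4)^{3/2}}\le\nu_p\le 6\,\frac{\sqrt{p+c_1}}{(p+c_3)^{3/2}},$$ $$\frac{\sqrt{(p+d_2)(p+d_3)}}{24}\le u_p\le\frac{\sqrt{(p+d_1)(p+d_4)}}{24},$$ $$\frac14\cdot\frac{\sqrt{(p+d_2)(p+d_3)(p+c_2)}}{(p+c_4)^{3/2}}\le U(\operatorname{rect}^{\{p\}})\le\frac14\cdot\frac{\sqrt{(p+d_1)(p+d_4)(p+c_1)}}{(p+c_3)^{3/2}}.$$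 In particular $\lim_{p\to\infty}U(\operatorname{rect}^{\{p\}})=\frac14$, and $\frac14=\inf_{p\ge 2}U(\operatorname{rect}^{\{p\}})$. -/

import Mathlib

open MeasureTheory Filter Topology
open scoped ENNReal

noncomputable section

/-- The squared norm `‖f‖²` in `L²(ℝ)`. All functions considered vanish outside a compact
interval `K`, so integrals over `K` and over `ℝ` agree. -/
def l2NormSq (f : ℝ → ℂ) : ℝ := ∫ x : ℝ, ‖f x‖ ^ 2

/-- The Fourier transform `f̂(ω) = ∫ e^{-iωx} f(x) dx`. -/
def fourierHat (f : ℝ → ℂ) (ω : ℝ) : ℂ := ∫ x : ℝ, Complex.exp (-(Complex.I * ω * x)) * f x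

/-- The mean in space, `α[f]`. -/
def spaceMean (f : ℝ → ℂ) : ℝ := (∫ x : ℝ, x * ‖f x‖ ^ 2) / l2NormSq f

/-- The mean in frequency, `β[f̂]`. -/
def freqMean (f : ℝ → ℂ) : ℝ :=
  (∫ ω : ℝ, ω * ‖fourierHat f ω‖ ^ 2) / (2 * Real.pi * l2NormSq f)

/-- The variance in space, `σ_x²[f]`. -/
def spaceVariance (f : ℝ → ℂ) : ℝ≥0∞ :=
  (∫⁻ x : ℝ, ENNReal.ofReal ((x - spaceMean f) ^ 2 * ‖f x‖ ^ 2)) / ENNReal.ofReal (l2NormSq f)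

/-- The variance in frequency, `σ_ω²[f̂]`; it may be `+∞`. -/
def freqVariance (f : ℝ → ℂ) : ℝ≥0∞ :=
  (∫⁻ ω : ℝ, ENNReal.ofReal ((ω - freqMean f) ^ 2 * ‖fourierHat f ω‖ ^ 2)) /
    ENNReal.ofReal (2 * Real.pi * l2NormSq f)

/-- The uncertainty `U[f] = σ_x²[f] · σ_ω²[f̂]`, with values in `[0, +∞]`. -/
def uncertainty (f : ℝ → ℂ) : ℝ≥0∞ := spaceVariance f * freqVariance f

/-- The `p`-fold self-convolution `rect^{p}` of the indicator function of `[-1/2, 1/2]`, for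
`p ≥ 1`; the value at `p = 0` is a placeholder. -/
def rectConv : ℕ → ℝ → ℝ
  | 0 => fun _ => 0
  | 1 => Set.indicator (Set.Icc (-(1 / 2)) (1 / 2)) (fun _ => 1)
  | p + 2 => fun x => ∫ s in (x - 1 / 2)..(x + 1 / 2), rectConv (p + 1) s

/-- `U(rect^{p})`. -/
def rectUncertainty (p : ℕ) : ℝ≥0∞ := uncertainty (fun x => (rectConv p x : ℂ))

/-- The frequency ratio `ν_p`, where `Real.sinc y = sin y / y`. -/
def nuRatio (p : ℕ) : ℝ :=
  (∫ ω : ℝ, ω ^ 2 * Real.sinc (ω / 2) ^ (2 * p)) / (∫ ω : ℝ, Real.sinc (ω / 2) ^ (2 * p))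

/-- The spatial ratio `u_p`. -/
def uRatio (p : ℕ) : ℝ :=
  (∫ x in (-(p / 2 : ℝ))..(p / 2 : ℝ), x ^ 2 * |rectConv p x| ^ 2) /
    (∫ x in (-(p / 2 : ℝ))..(p / 2 : ℝ), |rectConv p x| ^ 2)

end

/-! The transform of `rectConv p` is `sinc (ω / 2) ^ p`. Put A = ∫ sinc^(2p), N = ∫ y² sinc^(2p), E
= ∫ ((sinc^p)')². Rescaling gives ν_p = 4N/A, and Plancherel, applied to the spline and to x times
the spline, gives u_p = E/(4A). Both means vanish by parity, so U = u_p ν_p = NE/A².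

Near 0, sinc^(2p) behaves like the Gaussian exp(-p y²/3), whose variance is 3/(2p); hence ν_p ≈ 6/p
and u_p ≈ p/24. On [0, π] this becomes rigorous by integrating moments by parts: y sinc' = cos -
sinc, and sinc - cos lies between (y²/3) sinc and y²/3, so consecutive even moments control each
other. Beyond π the integrands are of size 9^(-p), negligible against A, for which a crude lower
bound of order 1/p suffices. With p = q + 2 this yields 6/(p + 3) ≤ ν_p ≤ 6/(p - 1) and u_p ≤ (p +
13)/24.

The Heisenberg inequality A² ≤ 4NE (`sincNorm_sq_le`) does the rest: it gives U ≥ 1/4, the lower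
bound u_p ≥ (p - 1)/24 from the upper bound on ν_p, and, with the upper bounds, the limit and the
infimum. The square-root forms are relaxations of these rational bounds. -/

/-! ### Pointwise estimates for `sinc` and its derivative -/

/-- The derivative of `Real.sinc`. -/
noncomputable def sincDeriv (y : ℝ) : ℝ := (Real.cos y - Real.sinc y) / y

lemma mul_sinc (y : ℝ) : y * Real.sinc y = Real.sin y := by
  rcases eq_or_ne y 0 with rfl | hy
  · simp
  · rw [Real.sinc_of_ne_zero hy]; field_simp

/-- Valid at 0 as well, since cos 0 = sinc 0; this is what turns derivatives of powers of sinc into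
sinc - cos. -/
lemma mul_sincDeriv (y : ℝ) : y * sincDeriv y = Real.cos y - Real.sinc y := by
  rcases eq_or_ne y 0 with rfl | hy
  · simp
  · rw [sincDeriv]; field_simp

lemma hasDerivAt_sinc {y : ℝ} (hy : y ≠ 0) : HasDerivAt Real.sinc (sincDeriv y) y := by
  have h : HasDerivAt (fun x => Real.sin x / x) (sincDeriv y) y := by
    refine ((Real.hasDerivAt_sin y).div (hasDerivAt_id y) hy).congr_deriv ?_
    simp only [sincDeriv, Real.sinc_of_ne_zero hy, id]
    field_simp
  refine h.congr_of_eventuallyEq ?_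
  filter_upwards [isOpen_ne.mem_nhds hy] with x hx
  exact Real.sinc_of_ne_zero hx

lemma sincDeriv_neg (y : ℝ) : sincDeriv (-y) = -sincDeriv y := by
  simp [sincDeriv, div_neg]

lemma measurable_sincDeriv : Measurable sincDeriv := by
  unfold sincDeriv
  exact (Real.measurable_cos.sub Real.continuous_sinc.measurable).div measurable_id

lemma sinc_nonneg {y : ℝ} (h0 : 0 ≤ y) (h1 : y ≤ Real.pi) : 0 ≤ Real.sinc y := by
  rcases h0.eq_or_lt with rfl | h
  · simp
  · rw [Real.sinc_of_ne_zero h.ne']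
    exact div_nonneg (Real.sin_nonneg_of_nonneg_of_le_pi h0 h1) h0

lemma sinc_pi : Real.sinc Real.pi = 0 := by
  rw [Real.sinc_of_ne_zero Real.pi_ne_zero]; simp

lemma one_sub_sq_div_six_le_sinc (y : ℝ) : 1 - y ^ 2 / 6 ≤ Real.sinc y := by
  wlog h : 0 ≤ y generalizing y
  · simpa using this (-y) (by linarith)
  rcases h.eq_or_lt with rfl | h
  · simp
  · rw [Real.sinc_of_ne_zero h.ne', le_div_iff₀ h]
    have := Real.sin_ge_sub_cube h.le
    linarith [this, show (1 - y ^ 2 / 6) * y = y - y ^ 3 / 6 by ring]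

/-- A function on `[0, b]` vanishing at `0` with nonnegative derivative is nonnegative. -/
lemma nonneg_of_hasDerivAt_nonneg {f f' : ℝ → ℝ} {b y : ℝ} (hd : ∀ x, HasDerivAt f (f' x) x)
    (h0 : f 0 = 0) (hn : ∀ x, 0 ≤ x → x ≤ b → 0 ≤ f' x) (hy : 0 ≤ y) (hyb : y ≤ b) :
    0 ≤ f y := by
  have hmono : MonotoneOn f (Set.Icc 0 b) := by
    refine monotoneOn_of_deriv_nonneg (convex_Icc 0 b)
      (fun x _ => (hd x).continuousAt.continuousWithinAt)
      (fun x _ => (hd x).differentiableAt.differentiableWithinAt) fun x hx => ?_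
    rw [interior_Icc] at hx
    rw [(hd x).deriv]
    exact hn x hx.1.le hx.2.le
  rw [← h0]
  exact hmono ⟨le_rfl, hy.trans hyb⟩ ⟨hy, hyb⟩ hy

lemma hasDerivAt_sin_sub_mul_cos (x : ℝ) :
    HasDerivAt (fun x => Real.sin x - x * Real.cos x) (x * Real.sin x) x := by
  refine ((Real.hasDerivAt_sin x).sub
    ((hasDerivAt_id x).mul (Real.hasDerivAt_cos x))).congr_deriv ?_
  simp

lemma sin_sub_mul_cos_nonneg {y : ℝ} (h0 : 0 ≤ y) (h1 : y ≤ Real.pi) :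
    0 ≤ Real.sin y - y * Real.cos y :=
  nonneg_of_hasDerivAt_nonneg (f := fun x => Real.sin x - x * Real.cos x)
    hasDerivAt_sin_sub_mul_cos (by simp)
    (fun _ hx hx' => mul_nonneg hx (Real.sin_nonneg_of_nonneg_of_le_pi hx hx')) h0 h1

/-- After multiplication by y, the difference of the two sides has derivative x² - x sin x ≥ 0.
Together with `le_sinc_sub_cos` it pins sinc - cos to y²/3 up to one factor sinc. -/
lemma sinc_sub_cos_le {y : ℝ} (h0 : 0 ≤ y) : Real.sinc y - Real.cos y ≤ y ^ 2 / 3 := by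
  have h : 0 ≤ y ^ 3 / 3 - (Real.sin y - y * Real.cos y) := by
    refine nonneg_of_hasDerivAt_nonneg
      (f := fun x => x ^ 3 / 3 - (Real.sin x - x * Real.cos x))
      (f' := fun x => x ^ 2 - x * Real.sin x) (b := y) (fun x => ?_) (by simp)
      (fun x hx _ => ?_) h0 le_rfl
    · refine (((hasDerivAt_pow 3 x).div_const 3).sub
        (hasDerivAt_sin_sub_mul_cos x)).congr_deriv ?_
      simp
    · nlinarith [Real.sin_le hx]
  rcases h0.eq_or_lt with rfl | hy
  · simp
  · rw [← mul_le_mul_iff_right₀ hy, mul_sub, mul_sinc]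
    linarith [show y * (y ^ 2 / 3) = y ^ 3 / 3 by ring]

/-- After multiplication by y, the difference of the two sides has derivative (x/3)(sin x - x cos
x), which is nonnegative on [0, π]. -/
lemma le_sinc_sub_cos {y : ℝ} (h0 : 0 ≤ y) (h1 : y ≤ Real.pi) :
    y ^ 2 / 3 * Real.sinc y ≤ Real.sinc y - Real.cos y := by
  have h : 0 ≤ Real.sin y - y * Real.cos y - y ^ 2 / 3 * Real.sin y := by
    refine nonneg_of_hasDerivAt_nonneg
      (f := fun x => Real.sin x - x * Real.cos x - x ^ 2 / 3 * Real.sin x)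
      (f' := fun x => x / 3 * (Real.sin x - x * Real.cos x)) (b := Real.pi) (fun x => ?_)
      (by simp) (fun x hx hx' => ?_) h0 h1
    · refine ((hasDerivAt_sin_sub_mul_cos x).sub
        (((hasDerivAt_pow 2 x).div_const 3).mul (Real.hasDerivAt_sin x))).congr_deriv ?_
      simp only [Nat.cast_ofNat]
      ring
    · exact mul_nonneg (by positivity) (sin_sub_mul_cos_nonneg hx hx')
  rcases h0.eq_or_lt with rfl | hy
  · simp
  · rw [← mul_le_mul_iff_right₀ hy, mul_sub, mul_left_comm, mul_sinc]
    linarith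

lemma abs_sincDeriv_le_div_three {y : ℝ} (h0 : 0 ≤ y) (h1 : y ≤ Real.pi) :
    |sincDeriv y| ≤ y / 3 := by
  rcases h0.eq_or_lt with rfl | hy
  · simp [sincDeriv]
  have h2 := le_sinc_sub_cos h0 h1
  have h3 := sinc_sub_cos_le h0
  have h4 := mul_nonneg (by positivity : 0 ≤ y ^ 2 / 3) (sinc_nonneg h0 h1)
  rw [sincDeriv, abs_div, abs_of_pos hy, div_le_iff₀ hy, abs_le]
  constructor <;> nlinarith

lemma abs_mul_abs_sincDeriv_le (y : ℝ) : |y| * |sincDeriv y| ≤ 2 := by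
  rw [← abs_mul, mul_sincDeriv]
  have := abs_sub (Real.cos y) (Real.sinc y)
  linarith [Real.abs_cos_le_one y, Real.abs_sinc_le_one y]

lemma abs_sincDeriv_le_two (y : ℝ) : |sincDeriv y| ≤ 2 := by
  wlog h : 0 ≤ y generalizing y
  · simpa [sincDeriv_neg] using this (-y) (by linarith)
  by_cases h1 : y ≤ 1
  · linarith [abs_sincDeriv_le_div_three h (by linarith [Real.pi_gt_three])]
  · have := abs_mul_abs_sincDeriv_le y
    rw [abs_of_nonneg h] at this
    nlinarith [abs_nonneg (sincDeriv y)]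

lemma abs_mul_abs_sinc_le (y : ℝ) : |y| * |Real.sinc y| ≤ 1 := by
  rw [← abs_mul, mul_sinc]; exact Real.abs_sin_le_one y

/-! ### Integrability -/

lemma integrable_of_one_add_sq_mul_le {g : ℝ → ℝ} (hg : Measurable g) (C : ℝ)
    (h : ∀ y, (1 + y ^ 2) * |g y| ≤ C) : Integrable g := by
  refine (integrable_inv_one_add_sq.const_mul C).mono' hg.aestronglyMeasurable
    (Eventually.of_forall fun y => ?_)
  have : 0 < 1 + y ^ 2 := by positivity
  rw [← div_eq_mul_inv, le_div_iff₀ this, Real.norm_eq_abs, mul_comm]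
  exact h y

lemma sq_sinc_mul_sq_le (y : ℝ) : y ^ 2 * Real.sinc y ^ 2 ≤ 1 := by
  rw [← mul_pow, mul_sinc]; exact Real.sin_sq_le_one y

lemma abs_sinc_pow_le_one (y : ℝ) (n : ℕ) : |Real.sinc y| ^ n ≤ 1 :=
  pow_le_one₀ (abs_nonneg _) (Real.abs_sinc_le_one y)

lemma sq_sinc_le_one (y : ℝ) : Real.sinc y ^ 2 ≤ 1 := by
  rw [← sq_abs]; exact abs_sinc_pow_le_one y 2

lemma integrable_sinc_pow {n : ℕ} (hn : 2 ≤ n) : Integrable (fun y => Real.sinc y ^ n) := by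
  obtain ⟨k, rfl⟩ := Nat.exists_eq_add_of_le hn
  refine integrable_of_one_add_sq_mul_le (Real.continuous_sinc.measurable.pow_const _) 2
    fun y => ?_
  rw [pow_add, abs_mul, abs_pow _ k, abs_of_nonneg (sq_nonneg _)]
  have h := abs_sinc_pow_le_one y k
  have h1 : (1 + y ^ 2) * Real.sinc y ^ 2 ≤ 2 := by
    linarith [sq_sinc_mul_sq_le y, sq_sinc_le_one y]
  have h2 : 0 ≤ (1 + y ^ 2) * Real.sinc y ^ 2 := by positivity
  rw [← mul_assoc]
  calc _ ≤ (1 + y ^ 2) * Real.sinc y ^ 2 * 1 := by gcongr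
    _ ≤ 2 := by linarith

lemma integrable_sq_mul_sinc_pow {n : ℕ} (hn : 4 ≤ n) :
    Integrable (fun y => y ^ 2 * Real.sinc y ^ n) := by
  obtain ⟨k, rfl⟩ := Nat.exists_eq_add_of_le hn
  refine integrable_of_one_add_sq_mul_le
    ((measurable_id.pow_const 2).mul (Real.continuous_sinc.measurable.pow_const _)) 2
    fun y => ?_
  have h1 : |y ^ 2 * Real.sinc y ^ (4 + k)|
      = (y ^ 2 * Real.sinc y ^ 2) * Real.sinc y ^ 2 * |Real.sinc y| ^ k := by
    rw [show y ^ 2 * Real.sinc y ^ (4 + k)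
      = ((y ^ 2 * Real.sinc y ^ 2) * Real.sinc y ^ 2) * Real.sinc y ^ k by ring, abs_mul,
      abs_pow _ k, abs_of_nonneg (by positivity)]
  have h2 : (1 + y ^ 2) * Real.sinc y ^ 2 ≤ 2 := by
    linarith [sq_sinc_mul_sq_le y, sq_sinc_le_one y]
  have h3 : 0 ≤ (1 + y ^ 2) * Real.sinc y ^ 2 := by positivity
  rw [h1]
  calc _ = (1 + y ^ 2) * Real.sinc y ^ 2 * (y ^ 2 * Real.sinc y ^ 2) * |Real.sinc y| ^ k := by ring
    _ ≤ 2 * 1 * 1 := by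
        gcongr
        · exact sq_sinc_mul_sq_le y
        · exact abs_sinc_pow_le_one y k
    _ = 2 := by norm_num

lemma integrable_sinc_pow_mul_sincDeriv {n : ℕ} (hn : 1 ≤ n) :
    Integrable (fun y => Real.sinc y ^ n * sincDeriv y) := by
  obtain ⟨k, rfl⟩ := Nat.exists_eq_add_of_le hn
  refine integrable_of_one_add_sq_mul_le
    ((Real.continuous_sinc.measurable.pow_const _).mul measurable_sincDeriv) 4
    fun y => ?_
  rw [abs_mul, abs_pow, pow_add, pow_one]
  have h1 : (1 + y ^ 2) * (|Real.sinc y| * |sincDeriv y|) ≤ 4 := by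
    have := mul_le_mul (abs_mul_abs_sinc_le y) (abs_mul_abs_sincDeriv_le y) (by positivity)
      zero_le_one
    have := mul_le_mul (Real.abs_sinc_le_one y) (abs_sincDeriv_le_two y) (by positivity)
      zero_le_one
    rw [← sq_abs y]
    linarith
  calc _ = (1 + y ^ 2) * (|Real.sinc y| * |sincDeriv y|) * |Real.sinc y| ^ k := by ring
    _ ≤ 4 * 1 := by
        gcongr
        exact abs_sinc_pow_le_one y k
    _ = 4 := by norm_num

lemma integrable_sinc_pow_mul_sincDeriv_sq {n : ℕ} (hn : 2 ≤ n) :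
    Integrable (fun y => Real.sinc y ^ n * sincDeriv y ^ 2) := by
  refine (integrable_sinc_pow hn).mul_bdd (c := 4)
    (measurable_sincDeriv.pow_const 2).aestronglyMeasurable (Eventually.of_forall fun y => ?_)
  rw [norm_pow, Real.norm_eq_abs]
  nlinarith [abs_sincDeriv_le_two y, abs_nonneg (sincDeriv y)]

/-- Splitting the integral of an even function over `ℝ` at `±π`. -/
lemma integral_eq_two_mul_of_even {g : ℝ → ℝ} (hg : Integrable g) (he : ∀ y, g (-y) = g y) :
    ∫ y, g y = 2 * ((∫ y in (0 : ℝ)..Real.pi, g y) + ∫ y in Set.Ioi Real.pi, g y) := by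
  have h : ∀ y, g |y| = g y := fun y => by
    rcases abs_choice y with h | h <;> rw [h]
    exact he y
  have h1 : ∫ y, g y = 2 * ∫ y in Set.Ioi 0, g y := by
    rw [← integral_comp_abs (f := g)]
    exact integral_congr_ae (Eventually.of_forall fun y => (h y).symm)
  rw [h1, intervalIntegral.integral_interval_add_Ioi hg.integrableOn hg.integrableOn]

/-! ### Moments of powers of `sinc` on `[0, π]` -/

/-- The `k`-th moment of `sinc ^ n` on `[0, π]`. -/
noncomputable def sincMoment (k n : ℕ) : ℝ := ∫ y in (0 : ℝ)..Real.pi, y ^ k * Real.sinc y ^ n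

lemma integral_zero_pi_mono {f g : ℝ → ℝ} (hf : Continuous f) (hg : Continuous g)
    (h : ∀ y, 0 ≤ y → y ≤ Real.pi → f y ≤ g y) :
    ∫ y in (0 : ℝ)..Real.pi, f y ≤ ∫ y in (0 : ℝ)..Real.pi, g y :=
  intervalIntegral.integral_mono_on Real.pi_pos.le (hf.intervalIntegrable _ _)
    (hg.intervalIntegrable _ _) fun y hy => h y hy.1 hy.2

/-- Integrate the derivative of y^(k+1) sinc^(n+1). The boundary terms vanish because sinc π = 0 and
k + 1 > 0, which is why the line is cut at π. -/
lemma sincMoment_integration_by_parts (k n : ℕ) :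
    (k + 1) * sincMoment k (n + 1) =
      (n + 1) * ∫ y in (0 : ℝ)..Real.pi,
        y ^ k * Real.sinc y ^ n * (Real.sinc y - Real.cos y) := by
  have h := intervalIntegral.integral_eq_sub_of_hasDerivAt_of_le (a := 0) (b := Real.pi)
    (f := fun y => y ^ (k + 1) * Real.sinc y ^ (n + 1))
    (f' := fun y => (k + 1) * (y ^ k * Real.sinc y ^ (n + 1)) -
      (n + 1) * (y ^ k * Real.sinc y ^ n * (Real.sinc y - Real.cos y)))
    Real.pi_pos.le (by fun_prop) (fun y hy => ?_)
    (Continuous.intervalIntegrable (by fun_prop) _ _)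
  · rw [intervalIntegral.integral_sub (Continuous.intervalIntegrable (by fun_prop) _ _)
      (Continuous.intervalIntegrable (by fun_prop) _ _), intervalIntegral.integral_const_mul,
      intervalIntegral.integral_const_mul] at h
    simp only [sinc_pi, ne_eq, Nat.add_eq_zero_iff, one_ne_zero, and_false, not_false_eq_true,
      zero_pow, mul_zero, zero_mul, sub_zero] at h
    unfold sincMoment
    linarith
  · refine ((hasDerivAt_pow (k + 1) y).mul
      ((hasDerivAt_sinc hy.1.ne').pow (n + 1))).congr_deriv ?_
    have := mul_sincDeriv y
    simp only [Nat.cast_add, Nat.cast_one, Nat.add_sub_cancel, Pi.pow_apply]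
    linear_combination (n + 1) * y ^ k * Real.sinc y ^ n * this

lemma sincMoment_add_two_le (k n : ℕ) :
    (n + 1) / 3 * sincMoment (k + 2) (n + 1) ≤ (k + 1) * sincMoment k (n + 1) := by
  rw [sincMoment_integration_by_parts, div_mul_eq_mul_div, mul_div_assoc, sincMoment,
    ← intervalIntegral.integral_div]
  refine mul_le_mul_of_nonneg_left ?_ (by positivity)
  refine integral_zero_pi_mono (by fun_prop) (by fun_prop) fun y h0 h1 => ?_
  have := mul_le_mul_of_nonneg_left (le_sinc_sub_cos h0 h1)
    (mul_nonneg (pow_nonneg h0 k) (pow_nonneg (sinc_nonneg h0 h1) n))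
  linarith [show y ^ k * Real.sinc y ^ n * (y ^ 2 / 3 * Real.sinc y)
    = y ^ (k + 2) * Real.sinc y ^ (n + 1) / 3 by ring]

/-- The upper bound y²/3 carries no factor sinc, so the right side has exponent n, one lower than in
`sincMoment_add_two_le`; `sincMoment_sub_le` repairs this shift. -/
lemma le_sincMoment_add_two (k n : ℕ) :
    (k + 1) * sincMoment k (n + 1) ≤ (n + 1) / 3 * sincMoment (k + 2) n := by
  rw [sincMoment_integration_by_parts, div_mul_eq_mul_div, mul_div_assoc, sincMoment,
    ← intervalIntegral.integral_div]
  refine mul_le_mul_of_nonneg_left ?_ (by positivity)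
  refine integral_zero_pi_mono (by fun_prop) (by fun_prop) fun y h0 h1 => ?_
  have := mul_le_mul_of_nonneg_left (sinc_sub_cos_le h0)
    (mul_nonneg (pow_nonneg h0 k) (pow_nonneg (sinc_nonneg h0 h1) n))
  linarith [show y ^ k * Real.sinc y ^ n * (y ^ 2 / 3)
    = y ^ (k + 2) * Real.sinc y ^ n / 3 by ring]

lemma sincMoment_sub_le (k n : ℕ) :
    sincMoment k n - sincMoment (k + 2) n / 6 ≤ sincMoment k (n + 1) := by
  unfold sincMoment
  rw [← intervalIntegral.integral_div, ← intervalIntegral.integral_sub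
    (Continuous.intervalIntegrable (by fun_prop) _ _)
    (Continuous.intervalIntegrable (by fun_prop) _ _)]
  refine integral_zero_pi_mono (by fun_prop) (by fun_prop) fun y h0 h1 => ?_
  have := mul_le_mul_of_nonneg_left (one_sub_sq_div_six_le_sinc y)
    (mul_nonneg (pow_nonneg h0 k) (pow_nonneg (sinc_nonneg h0 h1) n))
  linarith [show y ^ k * Real.sinc y ^ n * (1 - y ^ 2 / 6)
    = y ^ k * Real.sinc y ^ n - y ^ (k + 2) * Real.sinc y ^ n / 6 by ring,
    show y ^ k * Real.sinc y ^ (n + 1) = y ^ k * Real.sinc y ^ n * Real.sinc y by ring]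

lemma sincMoment_succ_le (k n : ℕ) : sincMoment k (n + 1) ≤ sincMoment k n := by
  refine integral_zero_pi_mono (by fun_prop) (by fun_prop) fun y h0 h1 => ?_
  have := mul_le_mul_of_nonneg_left (Real.sinc_le_one y)
    (mul_nonneg (pow_nonneg h0 k) (pow_nonneg (sinc_nonneg h0 h1) n))
  linarith [show y ^ k * Real.sinc y ^ (n + 1) = y ^ k * Real.sinc y ^ n * Real.sinc y by ring]

/-- Upper bound for the second moment; the exponent is `2p` with `p = q + 2`. -/
lemma sincMoment_two_le (q : ℕ) :
    sincMoment 2 (2 * (q + 2)) ≤ 3 / (2 * (q + 2)) * sincMoment 0 (2 * (q + 2)) := by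
  have h := sincMoment_add_two_le 0 (2 * q + 3)
  have hq : (0 : ℝ) < 2 * (q + 2) := by positivity
  simp only [show 2 * q + 3 + 1 = 2 * (q + 2) by ring, zero_add] at h
  push_cast at h
  rw [div_mul_eq_mul_div, le_div_iff₀ hq]
  linarith

/-- The recursion bounds the second moment at exponent 2p - 1. Raising the exponent by one costs a
sixth of the fourth moment, itself at most 9/(2q + 3) times the second, hence the factor 1 - 3/(4q +
6). -/
lemma le_sincMoment_two (q : ℕ) :
    3 / (2 * (q + 2)) * ((4 * q + 3) / (4 * q + 6)) * sincMoment 0 (2 * (q + 2)) ≤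
      sincMoment 2 (2 * (q + 2)) := by
  have h1 := le_sincMoment_add_two 0 (2 * q + 3)
  have h2 := sincMoment_sub_le 2 (2 * q + 3)
  have h3 := sincMoment_add_two_le 2 (2 * q + 2)
  simp only [show 2 * q + 3 + 1 = 2 * (q + 2) by ring, zero_add,
    show 2 * q + 2 + 1 = 2 * q + 3 by ring, show 2 + 2 = 4 by rfl] at h1 h2 h3
  push_cast at h1 h3
  have hq : (0 : ℝ) ≤ q := Nat.cast_nonneg q
  have h4 : sincMoment 4 (2 * q + 3) ≤ 9 / (2 * q + 3) * sincMoment 2 (2 * q + 3) := by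
    rw [div_mul_eq_mul_div, le_div_iff₀ (by positivity)]
    linarith
  have h5 : 3 / (2 * (q + 2)) * sincMoment 0 (2 * (q + 2)) ≤ sincMoment 2 (2 * q + 3) := by
    rw [div_mul_eq_mul_div, div_le_iff₀ (by positivity)]
    linarith
  have h6 : (4 * q + 3 : ℝ) / (4 * q + 6) = 1 - 9 / (2 * q + 3) / 6 := by
    field_simp
    ring
  have h7 : (4 * q + 3 : ℝ) / (4 * q + 6) * sincMoment 2 (2 * q + 3)
      ≤ sincMoment 2 (2 * (q + 2)) := by
    rw [h6]; linarith
  have h8 : (0 : ℝ) ≤ (4 * q + 3) / (4 * q + 6) := by positivity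
  calc _ = (4 * q + 3 : ℝ) / (4 * q + 6) *
        (3 / (2 * (q + 2)) * sincMoment 0 (2 * (q + 2))) := by ring
    _ ≤ _ := (mul_le_mul_of_nonneg_left h5 h8).trans h7

/-- By Bernoulli, sinc^(2p) ≥ (1 - y²/6)^(2p) ≥ 1 - p y²/3 near 0. The true order is p^(-1/2), but
1/p is enough to dominate the geometric tails. -/
lemma le_sincMoment_zero (q : ℕ) :
    21 / (16 * (q + 2)) ≤ sincMoment 0 (2 * (q + 2)) := by
  have hq : (0 : ℝ) ≤ q := Nat.cast_nonneg q
  -- With pa = 3/2 the integral of the minorant over [0, a] is a - a²/6, and a ≤ 3/4 makes this at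
  -- least 7a/8.
  set a : ℝ := 3 / (2 * (q + 2)) with ha
  have ha0 : 0 ≤ a := by positivity
  have ha1 : a ≤ 3 / 4 := by
    rw [ha]
    exact div_le_div_of_nonneg_left (by norm_num) (by norm_num) (by linarith)
  have h1 : ∫ y in (0 : ℝ)..a, (1 - (q + 2) / 3 * y ^ 2) = a - (q + 2) / 9 * a ^ 3 := by
    rw [intervalIntegral.integral_sub (Continuous.intervalIntegrable (by fun_prop) _ _)
      (Continuous.intervalIntegrable (by fun_prop) _ _), intervalIntegral.integral_const_mul,
      integral_pow]
    simp
    ring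
  have h2 : ∫ y in (0 : ℝ)..a, (1 - (q + 2) / 3 * y ^ 2)
      ≤ ∫ y in (0 : ℝ)..a, y ^ 0 * Real.sinc y ^ (2 * (q + 2)) := by
    refine intervalIntegral.integral_mono_on ha0
      (Continuous.intervalIntegrable (by fun_prop) _ _)
      (Continuous.intervalIntegrable (by fun_prop) _ _) fun y hy => ?_
    have hy1 : y ^ 2 ≤ 1 := by nlinarith [hy.1, hy.2]
    have h3 := one_add_mul_le_pow (a := -(y ^ 2 / 6)) (by linarith) (2 * (q + 2))
    have h4 : (1 + -(y ^ 2 / 6)) ^ (2 * (q + 2)) ≤ Real.sinc y ^ (2 * (q + 2)) :=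
      pow_le_pow_left₀ (by linarith) (by linarith [one_sub_sq_div_six_le_sinc y]) _
    push_cast at h3
    rw [pow_zero, one_mul]
    linarith
  have h3 : ∫ y in (0 : ℝ)..a, y ^ 0 * Real.sinc y ^ (2 * (q + 2))
      ≤ sincMoment 0 (2 * (q + 2)) := by
    refine intervalIntegral.integral_mono_interval le_rfl ha0
      (by linarith [Real.pi_gt_three]) ?_ (Continuous.intervalIntegrable (by fun_prop) _ _)
    refine Eventually.of_forall fun y => ?_
    simp only [pow_zero, one_mul, pow_mul]
    exact pow_nonneg (sq_nonneg _) _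
  refine le_trans ?_ (h1 ▸ h2.trans h3)
  have h4 : (q + 2) * a = 3 / 2 := by rw [ha]; field_simp
  have h5 : a - (q + 2) / 9 * a ^ 3 = a - a ^ 2 / 6 := by
    linear_combination (-a ^ 2 / 9) * h4
  have h6 : (21 : ℝ) / (16 * (q + 2)) = 7 / 8 * a := by rw [ha]; field_simp; norm_num
  rw [h5, h6]
  nlinarith

/-- Raising the exponent by two costs at most a third of the second moment, which is at most 3/(2q +
2) times the zeroth. -/
lemma sincMoment_zero_ratio (q : ℕ) :
    (2 * q + 1) * sincMoment 0 (2 * q + 2) ≤ (2 * q + 2) * sincMoment 0 (2 * (q + 2)) := by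
  have h1 := sincMoment_sub_le 0 (2 * q + 2)
  have h2 := sincMoment_sub_le 0 (2 * q + 2 + 1)
  have h3 := sincMoment_succ_le 2 (2 * q + 2)
  have h4 := sincMoment_add_two_le 0 (2 * q + 1)
  simp only [zero_add, show 2 * q + 1 + 1 = 2 * q + 2 by ring,
    show 2 * q + 2 + 1 + 1 = 2 * (q + 2) by ring] at h1 h2 h4
  push_cast at h4
  have hq : (0 : ℝ) ≤ q := Nat.cast_nonneg q
  have h5 : sincMoment 0 (2 * q + 2) - sincMoment 2 (2 * q + 2) / 3
      ≤ sincMoment 0 (2 * (q + 2)) := by linarith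
  have h6 := mul_le_mul_of_nonneg_left h5 (by positivity : (0 : ℝ) ≤ 2 * q + 2)
  linarith

/-- From |sinc'| ≤ y/3 the integral is at most a ninth of a second moment at exponent 2p - 2;
`sincMoment_zero_ratio` brings the exponent back to 2p. -/
lemma integral_sinc_pow_mul_sincDeriv_sq_le (q : ℕ) :
    ∫ y in (0 : ℝ)..Real.pi, Real.sinc y ^ (2 * q + 2) * sincDeriv y ^ 2 ≤
      sincMoment 0 (2 * (q + 2)) / (3 * (2 * q + 1)) := by
  have h1 : ∫ y in (0 : ℝ)..Real.pi, Real.sinc y ^ (2 * q + 2) * sincDeriv y ^ 2 ≤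
      sincMoment 2 (2 * q + 2) / 9 := by
    rw [sincMoment, ← intervalIntegral.integral_div]
    refine intervalIntegral.integral_mono_on Real.pi_pos.le
      (integrable_sinc_pow_mul_sincDeriv_sq (by omega)).intervalIntegrable
      (Continuous.intervalIntegrable (by fun_prop) _ _) fun y hy => ?_
    have h := pow_le_pow_left₀ (abs_nonneg _) (abs_sincDeriv_le_div_three hy.1 hy.2) 2
    rw [sq_abs] at h
    have := mul_le_mul_of_nonneg_left h (pow_nonneg (sinc_nonneg hy.1 hy.2) (2 * q + 2))
    linarith
  have h4 := sincMoment_add_two_le 0 (2 * q + 1)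
  have h5 := sincMoment_zero_ratio q
  simp only [zero_add, show 2 * q + 1 + 1 = 2 * q + 2 by ring] at h4
  push_cast at h4
  have hq : (0 : ℝ) ≤ q := Nat.cast_nonneg q
  refine h1.trans ?_
  rw [le_div_iff₀ (by positivity)]
  have h6 := mul_le_mul_of_nonneg_left h4 (by positivity : (0 : ℝ) ≤ 2 * q + 1)
  have h7 : (2 * q + 2) * ((2 * q + 1) * sincMoment 2 (2 * q + 2) / 3)
      ≤ (2 * q + 2) * sincMoment 0 (2 * (q + 2)) := by linarith
  have := le_of_mul_le_mul_left h7 (by positivity)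
  linarith

/-! ### Tails -/

lemma integral_Ioi_pi_inv_sq : ∫ y in Set.Ioi Real.pi, (y ^ 2)⁻¹ = Real.pi⁻¹ := by
  have h := integral_Ioi_rpow_of_lt (a := -2) (by norm_num) Real.pi_pos
  rw [show (-2 : ℝ) + 1 = -1 by norm_num, Real.rpow_neg_one] at h
  rw [← neg_div_neg_eq, neg_neg, neg_neg, div_one] at h
  rw [← h]
  refine setIntegral_congr_fun measurableSet_Ioi fun y hy => ?_
  have : 0 < y := Real.pi_pos.trans hy
  rw [Real.rpow_neg this.le, Real.rpow_two]

lemma integrableOn_Ioi_pi_inv_sq : IntegrableOn (fun y : ℝ => (y ^ 2)⁻¹) (Set.Ioi Real.pi) := by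
  refine (integrableOn_Ioi_rpow_of_lt (a := -2) (by norm_num) Real.pi_pos).congr_fun
    (fun y hy => ?_) measurableSet_Ioi
  have : 0 < y := Real.pi_pos.trans hy
  simp only
  rw [Real.rpow_neg this.le, Real.rpow_two]

/-- Comparison with C/y², whose integral beyond π is C/π. -/
lemma setIntegral_Ioi_pi_le {g : ℝ → ℝ} (hg : Integrable g) {C : ℝ} (hC : 0 ≤ C)
    (h : ∀ y, 3 < y → g y * y ^ 2 ≤ C) : ∫ y in Set.Ioi Real.pi, g y ≤ C / 3 := by
  have h1 : ∫ y in Set.Ioi Real.pi, g y ≤ ∫ y in Set.Ioi Real.pi, C * (y ^ 2)⁻¹ := by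
    refine setIntegral_mono_on hg.integrableOn (integrableOn_Ioi_pi_inv_sq.const_mul C)
      measurableSet_Ioi fun y hy => ?_
    have h3 : 3 < y := Real.pi_gt_three.trans hy
    have : 0 < y ^ 2 := by positivity
    rw [← div_eq_mul_inv, le_div_iff₀ this]
    exact h y h3
  refine h1.trans ?_
  rw [integral_const_mul, integral_Ioi_pi_inv_sq, ← div_eq_mul_inv]
  exact div_le_div_of_nonneg_left hC (by norm_num) Real.pi_gt_three.le

lemma sinc_sq_pow_le {y : ℝ} (hy : 3 < y) (q : ℕ) : Real.sinc y ^ (2 * q) ≤ (1 / 9) ^ q := by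
  rw [pow_mul]
  refine pow_le_pow_left₀ (sq_nonneg _) ?_ q
  nlinarith [sq_sinc_mul_sq_le y, sq_nonneg (Real.sinc y)]

lemma tail_sq_mul_sinc_pow_le (q : ℕ) :
    ∫ y in Set.Ioi Real.pi, y ^ 2 * Real.sinc y ^ (2 * (q + 2)) ≤ (1 / 9) ^ q / 3 := by
  refine setIntegral_Ioi_pi_le (integrable_sq_mul_sinc_pow (by omega)) (by positivity)
    fun y hy => ?_
  have h1 := sq_sinc_mul_sq_le y
  calc y ^ 2 * Real.sinc y ^ (2 * (q + 2)) * y ^ 2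
      = (y ^ 2 * Real.sinc y ^ 2) * (y ^ 2 * Real.sinc y ^ 2) * Real.sinc y ^ (2 * q) := by ring
    _ ≤ 1 * 1 * (1 / 9) ^ q := by
        gcongr
        · exact (even_two_mul q).pow_nonneg _
        · exact sinc_sq_pow_le hy q
    _ = _ := by ring

lemma tail_sinc_pow_le (q : ℕ) :
    ∫ y in Set.Ioi Real.pi, Real.sinc y ^ (2 * (q + 2)) ≤ (1 / 9) ^ q / 27 := by
  refine (setIntegral_Ioi_pi_le (C := (1 / 9) ^ q / 9) (integrable_sinc_pow (by omega))
    (by positivity) fun y hy => ?_).trans_eq (by ring)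
  have h1 := sq_sinc_mul_sq_le y
  calc Real.sinc y ^ (2 * (q + 2)) * y ^ 2
      = Real.sinc y ^ (2 * 1) * (y ^ 2 * Real.sinc y ^ 2) * Real.sinc y ^ (2 * q) := by ring
    _ ≤ (1 / 9) ^ 1 * 1 * (1 / 9) ^ q := by
        gcongr
        · exact (even_two_mul q).pow_nonneg _
        · exact sinc_sq_pow_le hy 1
        · exact sinc_sq_pow_le hy q
    _ = _ := by ring

lemma tail_sinc_pow_mul_sincDeriv_sq_le (q : ℕ) :
    ∫ y in Set.Ioi Real.pi, Real.sinc y ^ (2 * q + 2) * sincDeriv y ^ 2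
      ≤ 4 * (1 / 9) ^ q / 27 := by
  refine (setIntegral_Ioi_pi_le (C := 4 * (1 / 9) ^ q / 9)
    (integrable_sinc_pow_mul_sincDeriv_sq (by omega))
    (by positivity) fun y hy => ?_).trans_eq (by ring)
  have h1 : y ^ 2 * sincDeriv y ^ 2 ≤ 4 := by
    have := pow_le_pow_left₀ (by positivity) (abs_mul_abs_sincDeriv_le y) 2
    rw [mul_pow, sq_abs, sq_abs] at this
    linarith
  calc Real.sinc y ^ (2 * q + 2) * sincDeriv y ^ 2 * y ^ 2
      = Real.sinc y ^ (2 * 1) * (y ^ 2 * sincDeriv y ^ 2) * Real.sinc y ^ (2 * q) := by ring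
    _ ≤ (1 / 9) ^ 1 * 4 * (1 / 9) ^ q := by
        gcongr
        · exact (even_two_mul q).pow_nonneg _
        · exact sinc_sq_pow_le hy 1
        · exact sinc_sq_pow_le hy q
    _ = _ := by ring

/-- Lets the geometric tails absorb every polynomial prefactor that occurs below. -/
lemma sq_mul_le_mul_nine_pow (q : ℕ) : ((q : ℝ) + 2) ^ 2 * (q + 1) * (1 / 9) ^ q ≤ 5 := by
  have h : (q + 2) ^ 2 * (q + 1) ≤ 5 * 9 ^ q := by
    induction q with
    | zero => norm_num
    | succ q ih =>
      have : (q + 1 + 2) ^ 2 * (q + 1 + 1) ≤ 9 * ((q + 2) ^ 2 * (q + 1)) := by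
        ring_nf
        nlinarith
      calc _ ≤ 9 * ((q + 2) ^ 2 * (q + 1)) := this
        _ ≤ 9 * (5 * 9 ^ q) := by gcongr
        _ = _ := by ring
  have h' : ((q : ℝ) + 2) ^ 2 * (q + 1) ≤ 5 * 9 ^ q := by exact_mod_cast h
  rw [one_div, inv_pow, ← div_eq_mul_inv, div_le_iff₀ (by positivity)]
  exact h'

/-! ### Bounds for the integrals over the real line -/

/-- `∫ sinc ^ (2p)`, the squared norm of `sinc ^ p`. -/
noncomputable def sincNorm (p : ℕ) : ℝ := ∫ y, Real.sinc y ^ (2 * p)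

/-- `∫ y ^ 2 sinc ^ (2p)`. -/
noncomputable def sincSecondMoment (p : ℕ) : ℝ := ∫ y, y ^ 2 * Real.sinc y ^ (2 * p)

/-- The squared norm of the derivative of `sinc ^ p`. -/
noncomputable def sincEnergy (p : ℕ) : ℝ :=
  ∫ y, (p * Real.sinc y ^ (p - 1) * sincDeriv y) ^ 2

lemma sincNorm_eq (q : ℕ) : sincNorm (q + 2) = 2 * (sincMoment 0 (2 * (q + 2)) +
    ∫ y in Set.Ioi Real.pi, Real.sinc y ^ (2 * (q + 2))) := by
  rw [sincNorm, integral_eq_two_mul_of_even (integrable_sinc_pow (by omega)) (by simp)]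
  simp [sincMoment]

lemma sincSecondMoment_eq (q : ℕ) : sincSecondMoment (q + 2) =
    2 * (sincMoment 2 (2 * (q + 2)) +
      ∫ y in Set.Ioi Real.pi, y ^ 2 * Real.sinc y ^ (2 * (q + 2))) := by
  rw [sincSecondMoment, integral_eq_two_mul_of_even (integrable_sq_mul_sinc_pow (by omega))
    (by simp)]
  rfl

lemma sincEnergy_eq_mul_integral (q : ℕ) : sincEnergy (q + 2) =
    ((q : ℝ) + 2) ^ 2 * ∫ y, Real.sinc y ^ (2 * q + 2) * sincDeriv y ^ 2 := by
  rw [sincEnergy, ← integral_const_mul]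
  congr 1
  ext y
  simp only [show q + 2 - 1 = q + 1 by omega]
  push_cast
  ring

lemma sincEnergy_eq (q : ℕ) : sincEnergy (q + 2) = ((q : ℝ) + 2) ^ 2 *
    (2 * ((∫ y in (0 : ℝ)..Real.pi, Real.sinc y ^ (2 * q + 2) * sincDeriv y ^ 2) +
      ∫ y in Set.Ioi Real.pi, Real.sinc y ^ (2 * q + 2) * sincDeriv y ^ 2)) := by
  rw [sincEnergy_eq_mul_integral, integral_eq_two_mul_of_even
    (integrable_sinc_pow_mul_sincDeriv_sq (by omega)) (by simp [sincDeriv_neg])]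

lemma tail_sinc_pow_nonneg (q : ℕ) :
    0 ≤ ∫ y in Set.Ioi Real.pi, Real.sinc y ^ (2 * (q + 2)) :=
  integral_nonneg fun _ => (even_two_mul (q + 2)).pow_nonneg _

lemma sincMoment_zero_pos (q : ℕ) : 0 < sincMoment 0 (2 * (q + 2)) :=
  lt_of_lt_of_le (by positivity) (le_sincMoment_zero q)

lemma sincNorm_pos (q : ℕ) : 0 < sincNorm (q + 2) := by
  rw [sincNorm_eq]
  linarith [sincMoment_zero_pos q, tail_sinc_pow_nonneg q]

lemma sincSecondMoment_pos (q : ℕ) : 0 < sincSecondMoment (q + 2) := by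
  have h1 := le_sincMoment_two q
  have h2 : 0 ≤ ∫ y in Set.Ioi Real.pi, y ^ 2 * Real.sinc y ^ (2 * (q + 2)) :=
    integral_nonneg fun y => mul_nonneg (sq_nonneg _) ((even_two_mul (q + 2)).pow_nonneg _)
  have h3 : 0 < 3 / (2 * (q + 2)) * ((4 * q + 3) / (4 * q + 6)) * sincMoment 0 (2 * (q + 2)) :=
    mul_pos (by positivity) (sincMoment_zero_pos q)
  rw [sincSecondMoment_eq]
  linarith

/-- Weakening 6/p to 6/(p - 1) leaves, in the main term, a slack proportional to J/p, which pays for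
the tail of the second moment. -/
lemma sincSecondMoment_le (q : ℕ) :
    4 * sincSecondMoment (q + 2) * (q + 1) ≤ 6 * sincNorm (q + 2) := by
  rw [sincSecondMoment_eq, sincNorm_eq]
  have h1 := sincMoment_two_le q
  have h2 := tail_sq_mul_sinc_pow_le q
  have h3 := le_sincMoment_zero q
  have h4 := tail_sinc_pow_nonneg q
  have h5 := sq_mul_le_mul_nine_pow q
  set J := sincMoment 0 (2 * (q + 2))
  have hq : (0 : ℝ) ≤ q := Nat.cast_nonneg q
  set z : ℝ := (1 / 9) ^ q
  have h6 : z * (q + 1) ≤ 9 / 2 * J / (q + 2) := by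
    rw [le_div_iff₀ (by positivity)]
    rw [div_le_iff₀ (by positivity)] at h3
    have : z * (q + 1) * (q + 2) * (q + 2) ≤ 9 / 2 * J * (q + 2) := by nlinarith
    exact le_of_mul_le_mul_right this (by positivity)
  have h7 : 3 / (2 * ((q : ℝ) + 2)) * J * (q + 1) = 3 / 2 * J - 3 / 2 * J / (q + 2) := by
    field_simp
    ring
  have h8 := mul_le_mul_of_nonneg_right h1 (by positivity : (0 : ℝ) ≤ q + 1)
  have h9 := mul_le_mul_of_nonneg_right h2 (by positivity : (0 : ℝ) ≤ q + 1)
  have h10 : 9 / 2 * J / ((q : ℝ) + 2) = 3 * (3 / 2 * J / (q + 2)) := by ring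
  linarith

/-- The tail of the second moment is dropped. Using p + 3 instead of p leaves a positive surplus in
the main term (`h6`), which covers the tail of the norm. -/
lemma le_sincSecondMoment (q : ℕ) :
    6 * sincNorm (q + 2) ≤ 4 * sincSecondMoment (q + 2) * (q + 5) := by
  rw [sincSecondMoment_eq, sincNorm_eq]
  have h1 := le_sincMoment_two q
  have h2 : 0 ≤ ∫ y in Set.Ioi Real.pi, y ^ 2 * Real.sinc y ^ (2 * (q + 2)) :=
    integral_nonneg fun y => mul_nonneg (sq_nonneg _) ((even_two_mul (q + 2)).pow_nonneg _)
  have h3 := le_sincMoment_zero q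
  have h4 := tail_sinc_pow_le q
  have h5 := sq_mul_le_mul_nine_pow q
  have h0 := sincMoment_zero_pos q
  set J := sincMoment 0 (2 * (q + 2))
  have hq : (0 : ℝ) ≤ q := Nat.cast_nonneg q
  set z : ℝ := (1 / 9) ^ q
  have hz : 0 ≤ z := by positivity
  have h6 : 4 * (3 / (2 * ((q : ℝ) + 2)) * ((4 * q + 3) / (4 * q + 6)) * J) * (q + 5)
      = 6 * J + 6 * ((9 * q + 3) / ((q + 2) * (4 * q + 6)) * J) := by
    field_simp
    ring
  have h7 : z / 27 ≤ (9 * q + 3) / ((q + 2) * (4 * q + 6)) * J := by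
    have h8 : 21 * (9 * q + 3) / (16 * (q + 2) ^ 2 * (4 * q + 6))
        ≤ (9 * q + 3) / ((q + 2) * (4 * q + 6)) * J := by
      refine le_trans (le_of_eq ?_) (mul_le_mul_of_nonneg_left h3 (by positivity))
      field_simp
    refine le_trans ?_ h8
    rw [le_div_iff₀ (by positivity)]
    have h9 : ((q : ℝ) + 2) ^ 2 * z ≤ 5 := by
      nlinarith [mul_nonneg (mul_nonneg (sq_nonneg ((q : ℝ) + 2)) hq) hz]
    have h10 := mul_le_mul_of_nonneg_right h9 (by positivity : (0 : ℝ) ≤ 4 * q + 6)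
    nlinarith
  have h8 := mul_le_mul_of_nonneg_right h1 (by positivity : (0 : ℝ) ≤ q + 5)
  have h9 := mul_nonneg h2 (by positivity : (0 : ℝ) ≤ q + 5)
  linarith

/-- The 15 is 8 + 7: the part on [0, π] contributes J(q + 8) and the tail at most 7J. -/
lemma sincEnergy_le (q : ℕ) :
    24 * sincEnergy (q + 2) ≤ 4 * sincNorm (q + 2) * (q + 15) := by
  rw [sincEnergy_eq, sincNorm_eq]
  have h1 := integral_sinc_pow_mul_sincDeriv_sq_le q
  have h2 := tail_sinc_pow_mul_sincDeriv_sq_le q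
  have h3 := le_sincMoment_zero q
  have h4 := tail_sinc_pow_nonneg q
  have h5 := sq_mul_le_mul_nine_pow q
  set J := sincMoment 0 (2 * (q + 2))
  have hq : (0 : ℝ) ≤ q := Nat.cast_nonneg q
  set z : ℝ := (1 / 9) ^ q
  have hz : 0 ≤ z := by positivity
  have hJ : 0 ≤ J := le_trans (by positivity) h3
  have h6 : 6 * ((q : ℝ) + 2) ^ 2 * (J / (3 * (2 * q + 1))) ≤ J * (q + 8) := by
    rw [mul_div_assoc', div_le_iff₀ (by positivity)]
    have : 0 ≤ J * (3 * q * 13) := by positivity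
    linarith
  have h7 : 6 * ((q : ℝ) + 2) ^ 2 * (4 * z / 27) ≤ 7 * J := by
    rw [div_le_iff₀ (by positivity)] at h3
    have h8 : ((q : ℝ) + 2) ^ 2 * (q + 2) * z ≤ 10 := by
      have : 0 ≤ ((q : ℝ) + 2) ^ 2 * z * q := by positivity
      nlinarith
    have : 6 * ((q : ℝ) + 2) ^ 2 * (4 * z / 27) * (q + 2) ≤ 7 * J * (q + 2) := by
      linarith
    exact le_of_mul_le_mul_right this (by positivity)
  have h8 := mul_le_mul_of_nonneg_left (add_le_add h1 h2)
    (by positivity : (0 : ℝ) ≤ 6 * ((q : ℝ) + 2) ^ 2)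
  have h9 := mul_nonneg h4 (by positivity : (0 : ℝ) ≤ q + 15)
  linarith

/-! ### The uncertainty principle for `sinc ^ p` -/

lemma hasDerivAt_mul_sinc_pow {y : ℝ} (hy : y ≠ 0) (n : ℕ) :
    HasDerivAt (fun y => y * Real.sinc y ^ (n + 1))
      (Real.sinc y ^ (n + 1) + (n + 1) * (y * (Real.sinc y ^ n * sincDeriv y))) y := by
  refine ((hasDerivAt_id y).mul ((hasDerivAt_sinc hy).pow (n + 1))).congr_deriv ?_
  simp only [Nat.cast_add, Nat.cast_one, Nat.add_sub_cancel, Pi.pow_apply, id]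
  ring

lemma integrable_mul_sinc_pow_mul_sincDeriv {n : ℕ} (hn : 2 ≤ n) :
    Integrable (fun y => y * (Real.sinc y ^ n * sincDeriv y)) := by
  have h : (fun y => y * (Real.sinc y ^ n * sincDeriv y))
      = fun y => Real.sinc y ^ n * (Real.cos y - Real.sinc y) := by
    ext y; rw [← mul_sincDeriv]; ring
  rw [h]
  refine (integrable_sinc_pow hn).mul_bdd (c := 2)
    (Continuous.aestronglyMeasurable (by fun_prop)) (Eventually.of_forall fun y => ?_)
  have := abs_sub (Real.cos y) (Real.sinc y)
  rw [Real.norm_eq_abs]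
  linarith [Real.abs_cos_le_one y, Real.abs_sinc_le_one y]

lemma tendsto_mul_sinc_pow (n : ℕ) :
    Tendsto (fun y => y * Real.sinc y ^ (n + 2)) atTop (𝓝 0) := by
  refine squeeze_zero_norm' (a := fun y => y⁻¹) ?_ tendsto_inv_atTop_zero
  filter_upwards [eventually_gt_atTop 0] with y hy
  have h : y * Real.sinc y ^ (n + 2) = y * Real.sinc y ^ 2 * Real.sinc y ^ n := by ring
  rw [h, norm_mul, norm_pow, Real.norm_eq_abs, Real.norm_eq_abs, abs_of_nonneg (by positivity)]
  have h1 : y * Real.sinc y ^ 2 ≤ y⁻¹ := by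
    rw [← one_div, le_div_iff₀ hy]
    linarith [sq_sinc_mul_sq_le y]
  calc _ ≤ y * Real.sinc y ^ 2 * 1 := by
        gcongr
        exact abs_sinc_pow_le_one y n
    _ ≤ y⁻¹ := by linarith

lemma integral_Ioi_sinc_pow_add (n : ℕ) :
    ∫ y in Set.Ioi 0, (Real.sinc y ^ (n + 3) +
      ((n + 2 : ℕ) + 1) * (y * (Real.sinc y ^ (n + 2) * sincDeriv y))) = 0 := by
  have h := integral_Ioi_of_hasDerivAt_of_tendsto (a := 0) (m := 0)
    (f := fun y => y * Real.sinc y ^ (n + 3))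
    (f' := fun y => Real.sinc y ^ (n + 3) +
      ((n + 2 : ℕ) + 1) * (y * (Real.sinc y ^ (n + 2) * sincDeriv y)))
    (Continuous.continuousWithinAt (by fun_prop))
    (fun y hy => hasDerivAt_mul_sinc_pow (ne_of_gt hy) (n + 2))
    ((integrable_sinc_pow (by omega)).add
      ((integrable_mul_sinc_pow_mul_sincDeriv (by omega)).const_mul _)).integrableOn
    (tendsto_mul_sinc_pow (n + 1))
  rw [h]; simp

/-- Integrate (y sinc^(2p))' over the half-line, where both boundary terms vanish, and double by
evenness. Working on (0, ∞) avoids differentiating sinc at 0. -/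
lemma sincNorm_eq_neg (q : ℕ) : sincNorm (q + 2) =
    - ((2 * (q + 2)) * ∫ y, y * (Real.sinc y ^ (2 * q + 3) * sincDeriv y)) := by
  have hi1 : Integrable fun y => Real.sinc y ^ (2 * q + 1 + 3) := integrable_sinc_pow (by omega)
  have hi2 := (integrable_mul_sinc_pow_mul_sincDeriv (n := 2 * q + 1 + 2) (by omega)).const_mul
    (((2 * q + 1 + 2 : ℕ) : ℝ) + 1)
  have h1 := integral_Ioi_sinc_pow_add (2 * q + 1)
  have hi : Integrable fun y => Real.sinc y ^ (2 * q + 1 + 3) +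
      ((2 * q + 1 + 2 : ℕ) + 1) * (y * (Real.sinc y ^ (2 * q + 1 + 2) * sincDeriv y)) :=
    hi1.add hi2
  have h2 := integral_eq_two_mul_of_even hi (by simp [sincDeriv_neg])
  rw [intervalIntegral.integral_interval_add_Ioi hi.integrableOn hi.integrableOn, h1,
    mul_zero] at h2
  rw [integral_add hi1 hi2, integral_const_mul] at h2
  rw [sincNorm, show 2 * (q + 2) = 2 * q + 1 + 3 by ring]
  push_cast at h2 ⊢
  linear_combination h2

/-- Heisenberg by a discriminant: the integral of (t y sinc^p + (sinc^p)')² is t²N - tA + D, the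
cross term being evaluated by `sincNorm_eq_neg`. -/
lemma sincNorm_sq_le (q : ℕ) :
    sincNorm (q + 2) ^ 2 ≤ 4 * (sincSecondMoment (q + 2) * sincEnergy (q + 2)) := by
  set A := sincNorm (q + 2) with hA
  set N := sincSecondMoment (q + 2) with hN
  set D := sincEnergy (q + 2) with hD
  have hApos : 0 < A := sincNorm_pos q
  have hNpos : 0 < N := sincSecondMoment_pos q
  have key : ∀ t : ℝ, 0 ≤ t ^ 2 * N - t * A + D := by
    intro t
    have hi1 : Integrable fun y => t ^ 2 * (y ^ 2 * Real.sinc y ^ (2 * (q + 2))) :=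
      (integrable_sq_mul_sinc_pow (by omega)).const_mul _
    have hi2 : Integrable fun y => 2 * t * (q + 2) *
        (y * (Real.sinc y ^ (2 * q + 3) * sincDeriv y)) :=
      (integrable_mul_sinc_pow_mul_sincDeriv (by omega)).const_mul _
    have hi3 : Integrable fun y => ((q : ℝ) + 2) ^ 2 *
        (Real.sinc y ^ (2 * q + 2) * sincDeriv y ^ 2) :=
      (integrable_sinc_pow_mul_sincDeriv_sq (by omega)).const_mul _
    have hi12 : Integrable fun y => t ^ 2 * (y ^ 2 * Real.sinc y ^ (2 * (q + 2))) +
        2 * t * (q + 2) * (y * (Real.sinc y ^ (2 * q + 3) * sincDeriv y)) := hi1.add hi2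
    have h : 0 ≤ ∫ y, (t * y * Real.sinc y ^ (q + 2) +
        (q + 2) * Real.sinc y ^ (q + 1) * sincDeriv y) ^ 2 :=
      integral_nonneg fun y => sq_nonneg _
    have h1 : ∀ y, (t * y * Real.sinc y ^ (q + 2) +
        (q + 2) * Real.sinc y ^ (q + 1) * sincDeriv y) ^ 2 =
        t ^ 2 * (y ^ 2 * Real.sinc y ^ (2 * (q + 2))) +
          2 * t * (q + 2) * (y * (Real.sinc y ^ (2 * q + 3) * sincDeriv y)) +
          ((q : ℝ) + 2) ^ 2 * (Real.sinc y ^ (2 * q + 2) * sincDeriv y ^ 2) := fun y => by ring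
    simp only [h1] at h
    rw [integral_add hi12 hi3, integral_add hi1 hi2, integral_const_mul,
      integral_const_mul, integral_const_mul, ← sincEnergy_eq_mul_integral] at h
    have h2 := sincNorm_eq_neg q
    rw [hA, hN, hD, h2, sincSecondMoment]
    linear_combination h
  -- This t minimises the quadratic.
  have h := key (A / (2 * N))
  have h2 : (A / (2 * N)) ^ 2 * N - A / (2 * N) * A + D = D - A ^ 2 / (4 * N) := by
    field_simp
    ring
  rw [h2, sub_nonneg, div_le_iff₀ (by positivity)] at h
  linarith

/-! ### The functions `rectConv p` -/

lemma rectConv_eq_zero : ∀ (p : ℕ) {x : ℝ}, (p : ℝ) / 2 < |x| → rectConv p x = 0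
  | 0, _, _ => rfl
  | 1, x, h => by
    refine Set.indicator_of_notMem (fun hx => ?_) _
    have := abs_le.2 ⟨hx.1, hx.2⟩
    norm_num at h this
    linarith
  | p + 2, x, h => by
    have h0 : ∀ s ∈ Set.uIcc (x - 1 / 2) (x + 1 / 2), rectConv (p + 1) s = 0 := fun s hs => by
      rw [Set.uIcc_of_le (by linarith)] at hs
      refine rectConv_eq_zero (p + 1) ?_
      push_cast at h ⊢
      have h1 : |x - s| ≤ 1 / 2 := abs_le.2 ⟨by linarith [hs.2], by linarith [hs.1]⟩
      have h2 := abs_sub_abs_le_abs_sub x s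
      linarith
    change ∫ s in (x - 1 / 2)..(x + 1 / 2), rectConv (p + 1) s = 0
    rw [intervalIntegral.integral_congr h0, intervalIntegral.integral_zero]

lemma rectConv_one_of_mem {x : ℝ} (hx : x ∈ Set.Icc (-(1 / 2) : ℝ) (1 / 2)) :
    rectConv 1 x = 1 := Set.indicator_of_mem hx _

lemma rectConv_one_of_notMem {x : ℝ} (hx : x ∉ Set.Icc (-(1 / 2) : ℝ) (1 / 2)) :
    rectConv 1 x = 0 := Set.indicator_of_notMem hx _

lemma rectConv_neg : ∀ (p : ℕ) (x : ℝ), rectConv p (-x) = rectConv p x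
  | 0, _ => rfl
  | 1, x => by
    have h : -x ∈ Set.Icc (-(1 / 2) : ℝ) (1 / 2) ↔ x ∈ Set.Icc (-(1 / 2) : ℝ) (1 / 2) := by
      simp only [Set.mem_Icc]
      constructor <;> rintro ⟨h1, h2⟩ <;> constructor <;> linarith
    by_cases hx : x ∈ Set.Icc (-(1 / 2) : ℝ) (1 / 2)
    · rw [rectConv_one_of_mem hx, rectConv_one_of_mem (h.2 hx)]
    · rw [rectConv_one_of_notMem hx, rectConv_one_of_notMem (h.not.2 hx)]
  | p + 2, x => by
    change ∫ s in (-x - 1 / 2)..(-x + 1 / 2), rectConv (p + 1) s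
      = ∫ s in (x - 1 / 2)..(x + 1 / 2), rectConv (p + 1) s
    rw [← intervalIntegral.integral_congr (fun s _ => rectConv_neg (p + 1) s),
      intervalIntegral.integral_comp_neg]
    congr 1 <;> ring

/-- A sliding-window integral is a difference of two values of one primitive; continuity and
integrability then propagate together by induction. -/
lemma continuous_rectConv_of_integrable {p : ℕ} (h : Integrable (rectConv (p + 1))) :
    Continuous (rectConv (p + 2)) := by
  have hF := intervalIntegral.continuous_primitive (μ := volume)
    (fun a b => h.intervalIntegrable (a := a) (b := b)) 0
  have heq : rectConv (p + 2) = fun x => (∫ s in (0 : ℝ)..(x + 1 / 2), rectConv (p + 1) s) -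
      ∫ s in (0 : ℝ)..(x - 1 / 2), rectConv (p + 1) s := by
    ext x
    exact (intervalIntegral.integral_interval_sub_left h.intervalIntegrable
      h.intervalIntegrable).symm
  rw [heq]
  exact (hF.comp (continuous_add_const (1 / 2))).sub
    (hF.comp (by fun_prop : Continuous fun x : ℝ => x - 1 / 2))

lemma hasCompactSupport_rectConv (p : ℕ) : HasCompactSupport (rectConv p) := by
  refine HasCompactSupport.of_support_subset_isCompact
    (isCompact_Icc (a := -((p : ℝ) / 2)) (b := (p : ℝ) / 2)) fun x hx => ?_
  by_contra h
  refine hx (rectConv_eq_zero p ?_)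
  rw [Set.mem_Icc, ← abs_le] at h
  exact not_le.1 h

lemma integrable_rectConv : ∀ p : ℕ, Integrable (rectConv (p + 1))
  | 0 => (integrable_indicator_iff measurableSet_Icc).2
      (integrableOn_const (by simp))
  | p + 1 =>
    (continuous_rectConv_of_integrable (integrable_rectConv p)).integrable_of_hasCompactSupport
      (hasCompactSupport_rectConv _)

lemma continuous_rectConv (p : ℕ) : Continuous (rectConv (p + 2)) :=
  continuous_rectConv_of_integrable (integrable_rectConv p)

/-! ### Fourier transforms -/

open FourierTransform

lemma rectConv_eq_convolution (p : ℕ) :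
    (fun x => (rectConv (p + 2) x : ℂ)) =
      convolution (fun x => (rectConv 1 x : ℂ)) (fun x => (rectConv (p + 1) x : ℂ))
        (ContinuousLinearMap.mul ℂ ℂ) volume := by
  ext x
  have h : ∀ t, (ContinuousLinearMap.mul ℂ ℂ) (rectConv 1 t : ℂ) (rectConv (p + 1) (x - t) : ℂ)
      = ((Set.indicator (Set.Icc (-(1 / 2)) (1 / 2)) (fun t => rectConv (p + 1) (x - t)) t : ℝ) : ℂ) :=
    fun t => by
      rw [ContinuousLinearMap.mul_apply', ← Complex.ofReal_mul]
      congr 1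
      by_cases ht : t ∈ Set.Icc (-(1 / 2) : ℝ) (1 / 2)
      · rw [Set.indicator_of_mem ht, rectConv_one_of_mem ht, one_mul]
      · rw [Set.indicator_of_notMem ht, rectConv_one_of_notMem ht, zero_mul]
  rw [convolution_def]
  simp only [h]
  rw [integral_complex_ofReal, integral_indicator measurableSet_Icc, integral_Icc_eq_integral_Ioc,
    ← intervalIntegral.integral_of_le (by norm_num),
    intervalIntegral.integral_comp_sub_left (fun s => rectConv (p + 1) s), sub_neg_eq_add]
  rfl

lemma fourier_rectConv_one (ξ : ℝ) :
    𝓕 (fun x => (rectConv 1 x : ℂ)) ξ = Real.sinc (Real.pi * ξ) := by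
  rw [Real.fourier_real_eq_integral_exp_smul]
  have h : ∀ v : ℝ, Complex.exp (↑(-2 * Real.pi * v * ξ) * Complex.I) • (rectConv 1 v : ℂ)
      = Set.indicator (Set.Icc (-(1 / 2)) (1 / 2))
        (fun v : ℝ => Complex.exp (((-2 * Real.pi * ξ * v : ℝ) : ℂ) * Complex.I)) v := fun v => by
    by_cases hv : v ∈ Set.Icc (-(1 / 2) : ℝ) (1 / 2)
    · rw [Set.indicator_of_mem hv, rectConv_one_of_mem hv]
      simp only [Complex.ofReal_one, smul_eq_mul, mul_one]
      congr 3
      ring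
    · rw [Set.indicator_of_notMem hv, rectConv_one_of_notMem hv]
      simp
  simp only [h]
  rw [integral_indicator measurableSet_Icc, integral_Icc_eq_integral_Ioc,
    ← intervalIntegral.integral_of_le (by norm_num)]
  rcases eq_or_ne ξ 0 with rfl | hξ
  · simp
    norm_num
  have hc : -2 * Real.pi * ξ ≠ 0 := by
    simp [Real.pi_ne_zero, hξ]
  rw [intervalIntegral.integral_comp_mul_left
    (fun v : ℝ => Complex.exp ((v : ℂ) * Complex.I)) hc,
    show -2 * Real.pi * ξ * -(1 / 2) = -(-(Real.pi * ξ)) by ring,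
    show -2 * Real.pi * ξ * (1 / 2) = -(Real.pi * ξ) by ring,
    integral_exp_mul_I_eq_sinc, Real.sinc_neg]
  have h1 : (ξ : ℂ) ≠ 0 := by exact_mod_cast hξ
  have h2 : (Real.pi : ℂ) ≠ 0 := by exact_mod_cast Real.pi_ne_zero
  rw [Complex.real_smul]
  push_cast
  field_simp

lemma fourier_rectConv : ∀ (p : ℕ) (ξ : ℝ),
    𝓕 (fun x => (rectConv (p + 1) x : ℂ)) ξ = (Real.sinc (Real.pi * ξ) : ℂ) ^ (p + 1)
  | 0, ξ => by rw [fourier_rectConv_one, pow_one]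
  | p + 1, ξ => by
    have h1 : Integrable fun x => (rectConv 1 x : ℂ) := (integrable_rectConv 0).ofReal
    rw [rectConv_eq_convolution, Real.fourier_bilin_convolution_eq _ h1
      (integrable_rectConv p).ofReal, ContinuousLinearMap.mul_apply', fourier_rectConv_one, fourier_rectConv p ξ, ← pow_succ']

lemma fourierHat_rectConv (p : ℕ) (ω : ℝ) :
    fourierHat (fun x => (rectConv (p + 1) x : ℂ)) ω = (Real.sinc (ω / 2) : ℂ) ^ (p + 1) := by
  have h := fourier_rectConv p (ω / (2 * Real.pi))
  rw [show Real.pi * (ω / (2 * Real.pi)) = ω / 2 by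
    have := Real.pi_ne_zero
    field_simp] at h
  rw [← h, Real.fourier_real_eq_integral_exp_smul, fourierHat]
  congr 1
  ext x
  rw [smul_eq_mul]
  congr 2
  have : (Real.pi : ℂ) ≠ 0 := by exact_mod_cast Real.pi_ne_zero
  push_cast
  field_simp

/-- Plancherel's theorem for continuous integrable functions with integrable Fourier transform. -/
lemma integral_norm_sq_fourier_eq {f : ℝ → ℂ} (hc : Continuous f) (hf : Integrable f)
    (hf' : Integrable (𝓕 f)) : ∫ ξ, ‖𝓕 f ξ‖ ^ 2 = ∫ x, ‖f x‖ ^ 2 := by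
  -- Move one transform across the inner product; Fourier inversion then removes it.
  have h : ∫ ξ, innerSL ℂ (𝓕 f ξ) (𝓕 f ξ) = ∫ x, innerSL ℂ (f x) (𝓕⁻ (𝓕 f) x) := by
    have h := VectorFourier.integral_sesq_fourierIntegral_eq_neg_flip (innerSL ℂ)
      (L := innerₗ ℝ) Real.continuous_fourierChar continuous_inner hf hf'
    rw [flip_innerₗ] at h
    exact h
  rw [hc.fourierInv_fourier_eq hf hf'] at h
  apply Complex.ofRealLI.injective
  simpa [← LinearIsometry.integral_comp_comm, inner_self_eq_norm_sq_to_K] using h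

lemma norm_ofReal_sq (x : ℝ) : ‖(x : ℂ)‖ ^ 2 = x ^ 2 := by
  rw [Complex.norm_real, Real.norm_eq_abs, sq_abs]

lemma integral_comp_pi_mul (g : ℝ → ℝ) : ∫ ξ, g (Real.pi * ξ) = Real.pi⁻¹ * ∫ y, g y := by
  rw [Measure.integral_comp_mul_left, abs_of_pos (inv_pos.2 Real.pi_pos), smul_eq_mul]

lemma integral_rectConv_sq (q : ℕ) :
    ∫ x, rectConv (q + 2) x ^ 2 = Real.pi⁻¹ * sincNorm (q + 2) := by
  have hF : 𝓕 (fun x => (rectConv (q + 2) x : ℂ)) =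
      fun ξ => ((Real.sinc (Real.pi * ξ) ^ (q + 2) : ℝ) : ℂ) := by
    ext ξ; rw [fourier_rectConv (q + 1)]; push_cast; rfl
  have hi : Integrable (𝓕 (fun x => (rectConv (q + 2) x : ℂ))) := by
    rw [hF]
    exact ((integrable_sinc_pow (by omega)).comp_mul_left' Real.pi_ne_zero).ofReal
  have h := integral_norm_sq_fourier_eq
    (Complex.continuous_ofReal.comp (continuous_rectConv q))
    (integrable_rectConv (q + 1)).ofReal hi
  simp only [Function.comp_def] at h
  rw [hF] at h
  simp only [norm_ofReal_sq] at h
  rw [← h, sincNorm, ← integral_comp_pi_mul]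
  congr 1
  ext ξ
  ring

lemma integrable_mul_rectConv (q : ℕ) : Integrable (fun x : ℝ => x * rectConv (q + 2) x) :=
  (continuous_id.mul (continuous_rectConv q)).integrable_of_hasCompactSupport
    (hasCompactSupport_rectConv (q + 2)).mul_left

/-- Both sides are the derivative at ξ of sinc(πξ)^p, so uniqueness of derivatives identifies them.
The point ξ = 0, where `hasDerivAt_sinc` does not apply, is a null set. -/
lemma fourier_mul_rectConv (q : ℕ) {ξ : ℝ} (hξ : ξ ≠ 0) :
    𝓕 (fun x : ℝ => (-2 * Real.pi * Complex.I * x) • (rectConv (q + 2) x : ℂ)) ξ =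
      ((Real.pi * (((q : ℝ) + 2) *
        (Real.sinc (Real.pi * ξ) ^ (q + 1) * sincDeriv (Real.pi * ξ))) : ℝ) : ℂ) := by
  have hF : 𝓕 (fun x => (rectConv (q + 2) x : ℂ)) =
      fun ξ => ((Real.sinc (Real.pi * ξ) ^ (q + 2) : ℝ) : ℂ) := by
    ext ξ; rw [fourier_rectConv (q + 1)]; push_cast; rfl
  have hi' : Integrable (fun x : ℝ => x • (rectConv (q + 2) x : ℂ)) := by
    refine (integrable_mul_rectConv q).ofReal.congr (Eventually.of_forall fun x => ?_)
    simp
  have h1 := Real.hasDerivAt_fourier (integrable_rectConv (q + 1)).ofReal hi' ξ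
  have hne : Real.pi * ξ ≠ 0 := mul_ne_zero Real.pi_ne_zero hξ
  have h2 : HasDerivAt (fun ξ => Real.sinc (Real.pi * ξ) ^ (q + 2))
      (Real.pi * (((q : ℝ) + 2) *
        (Real.sinc (Real.pi * ξ) ^ (q + 1) * sincDeriv (Real.pi * ξ)))) ξ := by
    refine (((hasDerivAt_sinc hne).comp ξ
      ((hasDerivAt_id ξ).const_mul Real.pi)).pow (q + 2)).congr_deriv ?_
    simp only [Function.comp, show q + 2 - 1 = q + 1 by omega]
    push_cast
    ring
  rw [hF] at h1
  exact h1.unique h2.ofReal_comp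

/-- Plancherel for -2πi x f, whose transform is the derivative of sinc(πξ)^p. -/
lemma integral_sq_mul_rectConv_sq (q : ℕ) :
    ∫ x, x ^ 2 * rectConv (q + 2) x ^ 2 = (4 * Real.pi)⁻¹ * sincEnergy (q + 2) := by
  have hgc : Continuous fun x : ℝ =>
      (-2 * Real.pi * Complex.I * x) • (rectConv (q + 2) x : ℂ) :=
    (by fun_prop : Continuous fun x : ℝ => -2 * Real.pi * Complex.I * x).smul
      (Complex.continuous_ofReal.comp (continuous_rectConv q))
  have hgi : Integrable fun x : ℝ =>
      (-2 * Real.pi * Complex.I * x) • (rectConv (q + 2) x : ℂ) := by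
    refine ((integrable_mul_rectConv q).ofReal.const_mul (-2 * Real.pi * Complex.I)).congr
      (Eventually.of_forall fun x => ?_)
    simp [mul_assoc]
  set d : ℝ → ℝ := fun y => ((q : ℝ) + 2) * (Real.sinc y ^ (q + 1) * sincDeriv y) with hd
  have hae : 𝓕 (fun x : ℝ => (-2 * Real.pi * Complex.I * x) • (rectConv (q + 2) x : ℂ))
      =ᵐ[volume] fun ξ => ((Real.pi * d (Real.pi * ξ) : ℝ) : ℂ) := by
    have h0 : ∀ᵐ ξ : ℝ, ξ ≠ 0 := by simp [ae_iff]
    filter_upwards [h0] with ξ hξ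
    exact fourier_mul_rectConv q hξ
  have hdi : Integrable d := (integrable_sinc_pow_mul_sincDeriv (by omega)).const_mul _
  have hi := (((hdi.comp_mul_left' Real.pi_ne_zero).const_mul Real.pi).ofReal (𝕜 := ℂ)).congr
    hae.symm
  have h := integral_norm_sq_fourier_eq hgc hgi hi
  rw [integral_congr_ae (hae.mono fun ξ hξ => congrArg (fun z => ‖z‖ ^ 2) hξ)] at h
  simp only [norm_ofReal_sq] at h
  rw [integral_comp_pi_mul (fun y => (Real.pi * d y) ^ 2)] at h
  simp only [mul_pow Real.pi] at h
  have h4 : ∀ y, d y ^ 2 =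
      (((q + 2 : ℕ) : ℝ) * Real.sinc y ^ (q + 2 - 1) * sincDeriv y) ^ 2 := fun y => by
    simp only [hd, show q + 2 - 1 = q + 1 by omega]
    push_cast
    ring
  have h5 : ∀ x : ℝ, ‖(-2 * Real.pi * Complex.I * x) • (rectConv (q + 2) x : ℂ)‖ ^ 2
      = 4 * Real.pi ^ 2 * (x ^ 2 * rectConv (q + 2) x ^ 2) := fun x => by
    simp only [norm_smul, mul_pow, norm_mul, norm_neg, Complex.norm_I, norm_ofReal_sq,
      Complex.norm_ofNat]
    ring
  simp only [h4, h5] at h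
  rw [integral_const_mul, integral_const_mul] at h
  have := Real.pi_ne_zero
  rw [sincEnergy]
  field_simp at h ⊢
  linear_combination -h

/-! ### The ratios and the uncertainty -/

lemma integral_comp_half (g : ℝ → ℝ) : ∫ ω, g (ω / 2) = 2 * ∫ y, g y := by
  rw [Measure.integral_comp_div, abs_of_pos two_pos, smul_eq_mul]

lemma integral_sinc_half_pow (p : ℕ) :
    ∫ ω, Real.sinc (ω / 2) ^ (2 * p) = 2 * sincNorm p :=
  integral_comp_half fun y => Real.sinc y ^ (2 * p)

lemma integral_sq_mul_sinc_half_pow (p : ℕ) :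
    ∫ ω, ω ^ 2 * Real.sinc (ω / 2) ^ (2 * p) = 8 * sincSecondMoment p := by
  have h := integral_comp_half fun y => 4 * (y ^ 2 * Real.sinc y ^ (2 * p))
  rw [integral_const_mul 4 fun y => y ^ 2 * Real.sinc y ^ (2 * p)] at h
  rw [sincSecondMoment, show (8 : ℝ) = 2 * 4 by norm_num, mul_assoc, ← h]
  congr 1
  ext ω
  ring

lemma nuRatio_eq (p : ℕ) : nuRatio p = 4 * sincSecondMoment p / sincNorm p := by
  rw [nuRatio, integral_sinc_half_pow, integral_sq_mul_sinc_half_pow,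
    show 8 * sincSecondMoment p = 2 * (4 * sincSecondMoment p) by ring,
    mul_div_mul_left _ _ two_ne_zero]

lemma intervalIntegral_rectConv (p : ℕ) {g : ℝ → ℝ} (hg : ∀ x, rectConv p x = 0 → g x = 0) :
    ∫ x in (-(p / 2 : ℝ))..(p / 2 : ℝ), g x = ∫ x, g x := by
  have hp : (0 : ℝ) ≤ p := Nat.cast_nonneg p
  rw [intervalIntegral.integral_of_le (by linarith), ← integral_Icc_eq_integral_Ioc]
  refine setIntegral_eq_integral_of_forall_compl_eq_zero fun x hx => ?_
  refine hg x (rectConv_eq_zero p ?_)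
  rw [Set.mem_Icc, ← abs_le] at hx
  exact not_le.1 hx

lemma uRatio_eq (q : ℕ) : uRatio (q + 2) = sincEnergy (q + 2) / (4 * sincNorm (q + 2)) := by
  rw [uRatio, intervalIntegral_rectConv _ (fun x hx => by simp [hx]),
    intervalIntegral_rectConv _ (fun x hx => by simp [hx])]
  simp only [sq_abs]
  rw [integral_rectConv_sq, integral_sq_mul_rectConv_sq]
  have := Real.pi_ne_zero
  have := (sincNorm_pos q).ne'
  field_simp

lemma integral_eq_zero_of_odd {g : ℝ → ℝ} (h : ∀ x, g (-x) = -g x) : ∫ x, g x = 0 := by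
  have h1 := integral_neg_eq_self g volume
  simp only [h, integral_neg] at h1
  linarith

lemma rectUncertainty_eq (q : ℕ) :
    rectUncertainty (q + 2) = ENNReal.ofReal (uRatio (q + 2) * nuRatio (q + 2)) := by
  have hA := sincNorm_pos q
  have hpi := Real.pi_pos
  have hn : l2NormSq (fun x => (rectConv (q + 2) x : ℂ)) = Real.pi⁻¹ * sincNorm (q + 2) := by
    simp only [l2NormSq, norm_ofReal_sq, integral_rectConv_sq]
  have hf : ∀ ω, ‖fourierHat (fun x => (rectConv (q + 2) x : ℂ)) ω‖ ^ 2
      = Real.sinc (ω / 2) ^ (2 * (q + 2)) := fun ω => by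
    rw [fourierHat_rectConv (q + 1), ← Complex.ofReal_pow, norm_ofReal_sq]
    ring
  have hs : spaceMean (fun x => (rectConv (q + 2) x : ℂ)) = 0 := by
    rw [spaceMean, integral_eq_zero_of_odd (fun x => by rw [rectConv_neg]; ring), zero_div]
  have hw : freqMean (fun x => (rectConv (q + 2) x : ℂ)) = 0 := by
    simp only [freqMean, hf]
    rw [integral_eq_zero_of_odd (fun x => by rw [neg_div, Real.sinc_neg]; ring), zero_div]
  have hsv : spaceVariance (fun x => (rectConv (q + 2) x : ℂ)) =
      ENNReal.ofReal (uRatio (q + 2)) := by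
    have hi : Integrable fun x => x ^ 2 * rectConv (q + 2) x ^ 2 := by
      have hc : Continuous fun x => x ^ 2 * rectConv (q + 2) x ^ 2 :=
        (continuous_pow 2).mul ((continuous_rectConv q).pow 2)
      refine hc.integrable_of_hasCompactSupport ?_
      exact ((hasCompactSupport_rectConv (q + 2)).comp_left
        (g := fun y : ℝ => y ^ 2) (by simp)).mul_left
    simp only [spaceVariance, hs, hn, norm_ofReal_sq, sub_zero]
    rw [← ofReal_integral_eq_lintegral_ofReal hi (Eventually.of_forall fun x => by positivity),
      ← ENNReal.ofReal_div_of_pos (by positivity), integral_sq_mul_rectConv_sq, uRatio_eq]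
    congr 1
    field_simp
  have hfv : freqVariance (fun x => (rectConv (q + 2) x : ℂ)) =
      ENNReal.ofReal (nuRatio (q + 2)) := by
    have hi : Integrable fun ω : ℝ => ω ^ 2 * Real.sinc (ω / 2) ^ (2 * (q + 2)) := by
      have h := ((integrable_sq_mul_sinc_pow (n := 2 * (q + 2)) (by omega)).comp_div
        two_ne_zero).const_mul 4
      refine h.congr (Eventually.of_forall fun ω => ?_)
      simp only
      ring
    simp only [freqVariance, hw, hn, hf, sub_zero]
    rw [← ofReal_integral_eq_lintegral_ofReal hi (Eventually.of_forall fun x =>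
        mul_nonneg (sq_nonneg _) ((even_two_mul (q + 2)).pow_nonneg _)),
      ← ENNReal.ofReal_div_of_pos (by positivity), integral_sq_mul_sinc_half_pow, nuRatio_eq]
    congr 1
    field_simp
    ring
  have hu : 0 ≤ uRatio (q + 2) := by
    rw [uRatio_eq]
    exact div_nonneg (integral_nonneg fun y => sq_nonneg _) (by positivity)
  rw [rectUncertainty, uncertainty, hsv, hfv, ENNReal.ofReal_mul hu]

/-! ### Bounds for the ratios -/

lemma le_nuRatio (q : ℕ) : 6 / ((q : ℝ) + 5) ≤ nuRatio (q + 2) := by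
  rw [nuRatio_eq, div_le_div_iff₀ (by positivity) (sincNorm_pos q)]
  exact le_sincSecondMoment q

lemma nuRatio_le (q : ℕ) : nuRatio (q + 2) ≤ 6 / ((q : ℝ) + 1) := by
  rw [nuRatio_eq, div_le_div_iff₀ (sincNorm_pos q) (by positivity)]
  exact sincSecondMoment_le q

lemma uRatio_le (q : ℕ) : uRatio (q + 2) ≤ ((q : ℝ) + 15) / 24 := by
  have hA := sincNorm_pos q
  rw [uRatio_eq, div_le_div_iff₀ (by positivity) (by norm_num)]
  linarith [sincEnergy_le q]

lemma nuRatio_pos (q : ℕ) : 0 < nuRatio (q + 2) :=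
  lt_of_lt_of_le (by positivity) (le_nuRatio q)

/-- The Heisenberg uncertainty principle for `rectConv p`. -/
lemma one_fourth_le_uRatio_mul_nuRatio (q : ℕ) : 1 / 4 ≤ uRatio (q + 2) * nuRatio (q + 2) := by
  have hA := sincNorm_pos q
  have h : uRatio (q + 2) * nuRatio (q + 2) =
      sincSecondMoment (q + 2) * sincEnergy (q + 2) / sincNorm (q + 2) ^ 2 := by
    rw [uRatio_eq, nuRatio_eq]
    field_simp
  rw [h, div_le_div_iff₀ (by norm_num) (by positivity)]
  linarith [sincNorm_sq_le q]

/-- Heisenberg turns the upper bound on ν_p into this: u_p ≥ 1/(4ν_p) ≥ (p - 1)/24. -/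
lemma le_uRatio (q : ℕ) : ((q : ℝ) + 1) / 24 ≤ uRatio (q + 2) := by
  have h1 := one_fourth_le_uRatio_mul_nuRatio q
  have h2 := nuRatio_le q
  have h3 := nuRatio_pos q
  rw [le_div_iff₀ (by positivity)] at h2
  refine le_of_mul_le_mul_right ?_ h3
  linarith

lemma rpow_three_halves {x : ℝ} (hx : 0 < x) : x ^ (3 / 2 : ℝ) = x * √x := by
  rw [show (3 / 2 : ℝ) = 1 + 1 / 2 by norm_num, Real.rpow_add hx, Real.rpow_one,
    Real.sqrt_eq_rpow]

/-- Since y^(3/2) = y√y, enlarging or shrinking the radicand relative to y converts 1/y into the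
prescribed form. -/
lemma sqrt_div_rpow_le {x y : ℝ} (hy : 0 < y) (hxy : x ≤ y) :
    √x / y ^ (3 / 2 : ℝ) ≤ 1 / y := by
  have h : 0 < √y := Real.sqrt_pos.2 hy
  rw [rpow_three_halves hy, div_le_div_iff₀ (by positivity) hy]
  nlinarith [Real.sqrt_le_sqrt hxy]

lemma le_sqrt_div_rpow {x y : ℝ} (hy : 0 < y) (hxy : y ≤ x) :
    1 / y ≤ √x / y ^ (3 / 2 : ℝ) := by
  have h : 0 < √y := Real.sqrt_pos.2 hy
  rw [rpow_three_halves hy, div_le_div_iff₀ hy (by positivity)]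
  nlinarith [Real.sqrt_le_sqrt hxy]

lemma nuRatio_bounds (q : ℕ) :
    6 * (√(((q + 2 : ℕ) : ℝ) + 2) / (((q + 2 : ℕ) : ℝ) + 3) ^ (3 / 2 : ℝ)) ≤ nuRatio (q + 2) ∧
      nuRatio (q + 2) ≤
        6 * (√(((q + 2 : ℕ) : ℝ) + 1) / (((q + 2 : ℕ) : ℝ) + -1) ^ (3 / 2 : ℝ)) := by
  have hq : (0 : ℝ) ≤ q := Nat.cast_nonneg q
  push_cast
  constructor
  · have h := sqrt_div_rpow_le (x := (q : ℝ) + 2 + 2) (y := q + 2 + 3) (by positivity)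
      (by linarith)
    have h1 := le_nuRatio q
    rw [show (6 : ℝ) / (q + 5) = 6 * (1 / (q + 2 + 3)) by ring] at h1
    linarith
  · have h := le_sqrt_div_rpow (x := (q : ℝ) + 2 + 1) (y := q + 2 + -1) (by linarith)
      (by linarith)
    have h1 := nuRatio_le q
    rw [show (6 : ℝ) / (q + 1) = 6 * (1 / (q + 2 + -1)) by ring] at h1
    linarith

lemma uRatio_bounds (q : ℕ) :
    √((((q + 2 : ℕ) : ℝ) + -1) * (((q + 2 : ℕ) : ℝ) + -1)) / 24 ≤ uRatio (q + 2) ∧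
      uRatio (q + 2) ≤ √((((q + 2 : ℕ) : ℝ) + -(3 / 2)) * (((q + 2 : ℕ) : ℝ) + 500)) / 24 := by
  have hq : (0 : ℝ) ≤ q := Nat.cast_nonneg q
  push_cast
  constructor
  · rw [Real.sqrt_mul_self (by linarith)]
    have := le_uRatio q
    linarith
  · refine (uRatio_le q).trans (div_le_div_of_nonneg_right ?_ (by norm_num))
    refine Real.le_sqrt_of_sq_le ?_
    -- The claim is (q + 15)² ≤ (q + 1/2)(q + 502). The constant 500 is large because the first
    -- factor is only 1/2 at p = 2.
    nlinarith

lemma rectUncertainty_bounds (q : ℕ) :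
    ENNReal.ofReal (1 / 4 * (√((((q + 2 : ℕ) : ℝ) + -1) * (((q + 2 : ℕ) : ℝ) + -1) *
        (((q + 2 : ℕ) : ℝ) + 2)) / (((q + 2 : ℕ) : ℝ) + 3) ^ (3 / 2 : ℝ)))
        ≤ rectUncertainty (q + 2) ∧
      rectUncertainty (q + 2) ≤ ENNReal.ofReal (1 / 4 *
        (√((((q + 2 : ℕ) : ℝ) + -(3 / 2)) * (((q + 2 : ℕ) : ℝ) + 500) *
          (((q + 2 : ℕ) : ℝ) + 1)) / (((q + 2 : ℕ) : ℝ) + -1) ^ (3 / 2 : ℝ))) := by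
  have hp : (2 : ℝ) ≤ ((q + 2 : ℕ) : ℝ) := by push_cast; linarith [(Nat.cast_nonneg q : (0 : ℝ) ≤ q)]
  obtain ⟨hν1, hν2⟩ := nuRatio_bounds q
  obtain ⟨hu1, hu2⟩ := uRatio_bounds q
  rw [rectUncertainty_eq]
  generalize ((q + 2 : ℕ) : ℝ) = p at *
  have h1 : 0 < (p + 3) ^ (3 / 2 : ℝ) := Real.rpow_pos_of_pos (by linarith) _
  have h2 : 0 < (p + -1) ^ (3 / 2 : ℝ) := Real.rpow_pos_of_pos (by linarith) _
  have h3 : 0 ≤ √((p + -1) * (p + -1)) / 24 := by positivity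
  constructor <;> refine ENNReal.ofReal_le_ofReal ?_
  · rw [Real.sqrt_mul (mul_nonneg (by linarith) (by linarith))]
    refine le_trans (le_of_eq ?_) (mul_le_mul hu1 hν1 (by positivity) (h3.trans hu1))
    ring
  · rw [Real.sqrt_mul (mul_nonneg (by linarith) (by linarith))]
    refine (mul_le_mul hu2 hν2 (nuRatio_pos q).le (by positivity)).trans (le_of_eq ?_)
    ring

lemma one_fourth_le_rectUncertainty (q : ℕ) : 1 / 4 ≤ rectUncertainty (q + 2) := by
  rw [rectUncertainty_eq]
  refine le_trans (le_of_eq ?_) (ENNReal.ofReal_le_ofReal (one_fourth_le_uRatio_mul_nuRatio q))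
  rw [ENNReal.ofReal_div_of_pos (by norm_num)]
  simp

lemma tendsto_rectUncertainty : Tendsto rectUncertainty atTop (𝓝 (1 / 4)) := by
  rw [← tendsto_add_atTop_iff_nat 2]
  simp only [rectUncertainty_eq]
  rw [show (1 / 4 : ℝ≥0∞) = ENNReal.ofReal (1 / 4) by
    rw [ENNReal.ofReal_div_of_pos (by norm_num)]; simp]
  refine ENNReal.tendsto_ofReal ?_
  -- The majorant is (q + 15)/(4(q + 1)), the product of the upper bounds on u_p and ν_p.
  have hlim : Tendsto (fun q : ℕ => 1 / 4 + 7 / 2 * (1 / ((q : ℝ) + 1))) atTop (𝓝 (1 / 4)) := by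
    have h := ((tendsto_one_div_add_atTop_nhds_zero_nat (𝕜 := ℝ)).const_mul (7 / 2)).const_add
      (1 / 4)
    rwa [mul_zero, add_zero] at h
  refine tendsto_of_tendsto_of_tendsto_of_le_of_le tendsto_const_nhds hlim
    one_fourth_le_uRatio_mul_nuRatio fun q => ?_
  refine (mul_le_mul (uRatio_le q) (nuRatio_le q) (nuRatio_pos q).le (by positivity)).trans
    (le_of_eq ?_)
  field_simp
  ring

theorem mainTheorem6 :
    (∃ c₁ c₂ c₃ c₄ d₁ d₂ d₃ d₄ : ℝ,
      (c₁ ≠ 0 ∧ c₂ ≠ 0 ∧ c₃ ≠ 0 ∧ c₄ ≠ 0 ∧ d₁ ≠ 0 ∧ d₂ ≠ 0 ∧ d₃ ≠ 0 ∧ d₄ ≠ 0) ∧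
      (-2 < c₁ ∧ -2 < c₂ ∧ -2 < c₃ ∧ -2 < c₄ ∧ -2 < d₁ ∧ -2 < d₂ ∧ -2 < d₃ ∧ -2 < d₄) ∧
      (c₁ < c₂ ∧ c₃ < c₄ ∧ d₁ < d₂ ∧ d₃ < d₄) ∧
      ∀ p : ℕ, 2 ≤ p →
        (6 * (Real.sqrt (p + c₂) / (p + c₄) ^ (3 / 2 : ℝ)) ≤ nuRatio p ∧
          nuRatio p ≤ 6 * (Real.sqrt (p + c₁) / (p + c₃) ^ (3 / 2 : ℝ))) ∧
        (Real.sqrt ((p + d₂) * (p + d₃)) / 24 ≤ uRatio p ∧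
          uRatio p ≤ Real.sqrt ((p + d₁) * (p + d₄)) / 24) ∧
        (ENNReal.ofReal (1 / 4 *
            (Real.sqrt ((p + d₂) * (p + d₃) * (p + c₂)) / (p + c₄) ^ (3 / 2 : ℝ)))
            ≤ rectUncertainty p ∧
          rectUncertainty p ≤ ENNReal.ofReal (1 / 4 *
            (Real.sqrt ((p + d₁) * (p + d₄) * (p + c₁)) / (p + c₃) ^ (3 / 2 : ℝ))))) ∧
    Tendsto rectUncertainty atTop (𝓝 (1 / 4)) ∧
    IsGLB (rectUncertainty '' {p : ℕ | 2 ≤ p}) (1 / 4) := by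
  -- Here c₃ = -1 and c₄ = 3 come from the bounds on ν_p, and c₁ < c₂ need only satisfy c₁ ≥ c₃ and
  -- c₂ ≤ c₄. Likewise d₂ = d₃ = -1 come from u_p ≥ (p - 1)/24; then d₁ must lie in (-2, -1), and d₄
  -- compensates for it.
  refine ⟨⟨1, 2, -1, 3, -(3 / 2), -1, -1, 500, by norm_num, by norm_num, by norm_num,
    fun p hp => ?_⟩, tendsto_rectUncertainty, ?_, fun b hb => ?_⟩
  · obtain ⟨q, rfl⟩ := Nat.exists_eq_add_of_le' hp
    exact ⟨nuRatio_bounds q, uRatio_bounds q, rectUncertainty_bounds q⟩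
  · rintro _ ⟨p, hp, rfl⟩
    obtain ⟨q, rfl⟩ := Nat.exists_eq_add_of_le' (show 2 ≤ p from hp)
    exact one_fourth_le_rectUncertainty q
  -- A lower bound for all terms is at most their limit 1/4.
  · refine ge_of_tendsto tendsto_rectUncertainty ?_
    filter_upwards [eventually_ge_atTop 2] with p hp
    exact hb ⟨p, hp, rfl⟩
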